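/- Let $\boldsymbol{\alpha}=(\alpha_1,\dots,\alpha_d)\in(0,1)^d$ with $\sum_i\alpha_i=1$, let $\mathbf 1^\perp=\{\mathbf x\in\mathbb R^d:\sum_i x_i=0\}$ (interiors, closures and the Lebesgue measure $\mathrm{Leb}$ below are taken in $\mathbf 1^\perp$), and let $\Lambda=\mathbb Z^d\cap\mathbf 1^\perp$. For real $C\ge0$, $C'\ge1-\frac1d$ and $1\le i\le d$, let $S_{\boldsymbol\alpha,C,C',i}$ be the set of $\mathbf x\in\mathbf 1^\perp\cap[-C',\infty)^d$ such that $x_i+\alpha_i-1\ge-C'$ and $\frac{C-x_i}{\alpha_i}\le\frac{C-x_j}{\alpha_j}$ for all $j$ with $x_j+\alpha_j-1\ge-C'$. Let $\hat T_{\boldsymbol\alpha,C,C'}$ be the map of $\mathbf 1^\perp\cap[-C',\infty)^d$ to itself with $\hat T_{\boldsymbol\alpha,C,C'}(\mathbf x)=\mathbf x+\boldsymbol\alpha-\mathbf e_i$ for the smallest $i$ with $\mathbf x\in S_{\boldsymbol\alpha,C,C',i}$. Call $(\boldsymbol\alpha,C,C',\mathbf x_0)$, $\mathbf x_0\in\mathbf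 1^\perp$, Tijdeman parameters if $\alpha_1,\dots,\alpha_d$ are linearly independent over $\mathbb Q$, $C\ge0$, $C'\ge1-\frac1d$, and $\hat T^n_{\boldsymbol\alpha,C,C'}(\mathbf x_0)\in[-C',C]^d$ for all $n\ge0$. Put $$D_{\boldsymbol\alpha,C,C'}=\overline{\{\hat T^n_{\boldsymbol\alpha,C,C'}(\mathbf 0):n\ge0\}},\qquad P_{\boldsymbol\alpha,C,C'}=\overline{\mathring D_{\boldsymbol\alpha,C,C'}},\qquad P_{\boldsymbol\alpha,C,C',i}=\overline{\mathring P_{\boldsymbol\alpha,C,C'}\cap\mathring S_{\boldsymbol\alpha,C,C',i}}.$$ **Proposition.** Let $(\boldsymbol\alpha,C,C',\mathbf 0)$ be Tijdeman parameters with $C,C'\in\big[1-\frac{1+\min_i\alpha_i}{2d-2},1\big)$, and write $P=P_{\boldsymbol\alpha,C,C'}$, $P_i=P_{\boldsymbol\alpha,C,C',i}$, $\hat T=\hat T_{\boldsymbol\alpha,C,C'}$. Then: 1. $P$ is a measurable fundamental domain of $\mathbf 1^\perp/\Lambda$, i.e. $P$ is measurable, $P+\Lambda=\mathbf 1^\perp$,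 and $\mathrm{Leb}(P\cap(P+\mathbf n))=0$ for all $\mathbf n\in\Lambda\setminus\{\mathbf 0\}$. 2. $\{P_1,\dots,P_d\}$ is a natural partition of $P$ with respect to the translation of $\mathbf 1^\perp/\Lambda$ by the class of $\boldsymbol\alpha-\mathbf e_d$, i.e. this translation is minimal, $\bigcup_iP_i=P$, $\mathrm{Leb}(P_i\cap P_j)=0$ for $i\ne j$, each $P_i$ is the closure of its interior with $\mathrm{Leb}(\partial P_i)=0$, and there are $\mathbf t_i\in(\boldsymbol\alpha-\mathbf e_d)+\Lambda$ with $\mathbf t_i+P_i\subset P$. 3. The restriction of $\hat T$ to $P$ (defined almost everywhere, with the Lebesgue measure on $P$ normalized to total mass $1$) is measurably conjugate to the translation $T_{\boldsymbol\alpha}:\mathbf x\mapsto\mathbf x+(\alpha_1,\dots,\alpha_{d-1})$ on $\mathbb T^{d-1}=\mathbb R^{d-1}/\mathbb Z^{d-1}$ with the Haar probability measure: both systems preserve their measures, and there is a measure preserving measurable bijection, with measurable inverse, between invariant measurable sets of full measure that intertwines the two maps. 4. Each $P_i$ is the union of a finite nonempty family of convex polytopes (convex hulls of finitely many points) with nonempty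 interiors. 5. For Lebesgue-almost every $\mathbf x_0\in P$, $(\boldsymbol\alpha,C,C',\mathbf x_0)$ are Tijdeman parameters. -/

import Mathlib

open Set Filter Topology MeasureTheory
open scoped Pointwise

noncomputable section

/-! General notions: fundamental domains, natural partitions, polytopes, conjugacy. -/

/-- `P` is a measurable fundamental domain of the torus `V / Λ`, where `Leb` is a Lebesgue measure
on `V`. -/
structure IsMeasurableFundamentalDomain {V : Type*} [AddCommGroup V] [MeasurableSpace V]
    (Leb : Measure V) (Λ : AddSubgroup V) (P : Set V) : Prop where
  measurableSet : MeasurableSet P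
  add_lattice : P + (Λ : Set V) = univ
  null_overlap : ∀ n ∈ Λ, n ≠ 0 → Leb (P ∩ (n +ᵥ P)) = 0

/-- The translation by `a` on the torus `V / Λ` is minimal: every forward orbit is dense. -/
def IsMinimalTranslation {V : Type*} [AddCommGroup V] [TopologicalSpace V]
    (Λ : AddSubgroup V) (a : V) : Prop :=
  ∀ x : V ⧸ Λ, Dense (range fun n : ℕ => (fun y : V ⧸ Λ => y + (a : V ⧸ Λ))^[n] x)

/-- The family `Q` is a natural partition of `P` with respect to the translation by `a` on the torus
`V / Λ` (a partition up to null sets). The notion presupposes that `P` is a measurable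
fundamental domain and that the translation is minimal; both are included. -/
structure IsNaturalPartition {V : Type*} [AddCommGroup V] [TopologicalSpace V] [MeasurableSpace V]
    {ι : Type*} (Leb : Measure V) (Λ : AddSubgroup V) (a : V) (P : Set V) (Q : ι → Set V) :
    Prop where
  fundamentalDomain : IsMeasurableFundamentalDomain Leb Λ P
  minimal : IsMinimalTranslation Λ a
  iUnion_eq : ⋃ i, Q i = P
  null_inter : ∀ i j, i ≠ j → Leb (Q i ∩ Q j) = 0
  closure_interior : ∀ i, closure (interior (Q i)) = Q i
  null_frontier : ∀ i, Leb (frontier (Q i)) = 0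
  exists_translation : ∃ t : ι → V, ∀ i, t i - a ∈ Λ ∧ t i +ᵥ Q i ⊆ P

/-- A convex polytope: the convex hull of finitely many points. -/
def IsConvexPolytope {V : Type*} [AddCommGroup V] [Module ℝ V] (K : Set V) : Prop :=
  ∃ F : Set V, F.Finite ∧ K = convexHull ℝ F

/-- `A` is the union of a finite nonempty family of convex polytopes with nonempty interiors. -/
def IsFinitePolytopeUnion {V : Type*} [AddCommGroup V] [Module ℝ V] [TopologicalSpace V]
    (A : Set V) : Prop :=
  ∃ 𝒦 : Set (Set V), 𝒦.Finite ∧ 𝒦.Nonempty ∧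
    (∀ K ∈ 𝒦, IsConvexPolytope K ∧ (interior K).Nonempty) ∧ A = ⋃₀ 𝒦

/-- Measurable conjugacy of the probability measure preserving systems `(X, S, μ)` and
`(Y, T, ν)`: an isomorphism between invariant measurable subsets of full measure. -/
def MeasurablyConjugate {X Y : Type*} [MeasurableSpace X] [MeasurableSpace Y]
    (μ : Measure X) (S : X → X) (ν : Measure Y) (T : Y → Y) : Prop :=
  IsProbabilityMeasure μ ∧ IsProbabilityMeasure ν ∧
  MeasurePreserving S μ μ ∧ MeasurePreserving T ν ν ∧
  ∃ (X₀ : Set X) (Y₀ : Set Y) (hS : MapsTo S X₀ X₀) (_ : MapsTo T Y₀ Y₀) (Φ : X₀ ≃ᵐ Y₀),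
    MeasurableSet X₀ ∧ MeasurableSet Y₀ ∧ μ X₀ = 1 ∧ ν Y₀ = 1 ∧
    MeasurePreserving Φ (μ.comap Subtype.val) (ν.comap Subtype.val) ∧
    ∀ x : X₀, (Φ ⟨S x, hS x.2⟩ : Y) = T (Φ x)

/-! The hyperplane `1^⊥`, its integer lattice, frequency vectors. -/

/-- The hyperplane of vectors in `ℝ^d` whose coordinates sum to zero. -/
def onePerp (d : ℕ) : Submodule ℝ (Fin d → ℝ) where
  carrier := {x | ∑ i, x i = 0}
  add_mem' := by
    intro x y hx hy
    simp only [mem_ofPred_eq] at hx hy ⊢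
    simp [Finset.sum_add_distrib, hx, hy]
  zero_mem' := by simp
  smul_mem' := by
    intro c x hx
    simp only [mem_ofPred_eq] at hx ⊢
    simp [← Finset.mul_sum, hx]

/-- The lattice `ℤ^d ∩ 1^⊥` in `1^⊥`. -/
def onePerpLattice (d : ℕ) : AddSubgroup (onePerp d) where
  carrier := {x | ∀ i, ∃ n : ℤ, (x : Fin d → ℝ) i = n}
  add_mem' := by
    intro x y hx hy i
    obtain ⟨m, hm⟩ := hx i
    obtain ⟨n, hn⟩ := hy i
    exact ⟨m + n, by simp [hm, hn]⟩
  zero_mem' := fun i => ⟨0, by simp⟩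
  neg_mem' := by
    intro x hx i
    obtain ⟨m, hm⟩ := hx i
    exact ⟨-m, by simp [hm]⟩

/-- A Lebesgue measure on `1^⊥`, i.e. a translation invariant measure that is finite on compact
sets and positive on nonempty open sets; it is determined up to a positive constant, which is
irrelevant for null sets and for normalized restrictions. (`volume` would be the restriction of the
measure of `ℝ^d` to the subtype, which is zero.) -/
def lebOnePerp (d : ℕ) : Measure (onePerp d) := Measure.addHaar

/-- A frequency vector: `α ∈ (0,1)^d` with coordinates summing to one. -/
structure FrequencyVector (d : ℕ) where
  coord : Fin d → ℝ
  pos : ∀ i, 0 < coord i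
  lt_one : ∀ i, coord i < 1
  sum_eq_one : ∑ i, coord i = 1

namespace FrequencyVector

variable {d : ℕ}

/-- Totally irrational: the coordinates are rationally independent. -/
def TotallyIrrational (α : FrequencyVector d) : Prop := LinearIndependent ℚ α.coord

/-- The vector `α - e_i`, an element of `1^⊥`. -/
def step (α : FrequencyVector d) (i : Fin d) : onePerp d :=
  ⟨α.coord - Pi.single i 1, by
    simp [onePerp, Finset.sum_sub_distrib, α.sum_eq_one]⟩

/-- The translation `x ↦ x + (α_1, …, α_{d-1})` on the torus `𝕋^{d-1} = ℝ^{d-1} / ℤ^{d-1}`. -/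
def torusTranslation (α : FrequencyVector d) (x : UnitAddTorus (Fin (d - 1))) :
    UnitAddTorus (Fin (d - 1)) :=
  fun k => x k + (α.coord (Fin.castLE (Nat.sub_le d 1) k) : UnitAddCircle)

/-- There is at least one coordinate. -/
theorem card_pos (α : FrequencyVector d) : 0 < d := by
  rcases Nat.eq_zero_or_pos d with h | h
  · subst h
    simpa using α.sum_eq_one
  · exact h

/-- The last index `d`. -/
def last (α : FrequencyVector d) : Fin d := ⟨d - 1, Nat.sub_lt α.card_pos Nat.one_pos⟩

/-! The dynamical system behind the sequences. -/

/-- The set `S_{α,C,C',i}`. -/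
def S (α : FrequencyVector d) (C C' : ℝ) (i : Fin d) : Set (onePerp d) :=
  {x | (∀ j, -C' ≤ x.1 j) ∧ -C' ≤ x.1 i + α.coord i - 1 ∧
    ∀ j, -C' ≤ x.1 j + α.coord j - 1 → (C - x.1 i) / α.coord i ≤ (C - x.1 j) / α.coord j}

open Classical in
/-- The map `T̂_{α,C,C'}`: `x ↦ x + α - e_i` for the smallest `i` with `x ∈ S_{α,C,C',i}`. For
`C' ≥ 1 - 1/d` such an `i` exists at every point of `1^⊥ ∩ [-C',∞)^d`, the domain of the map; at all
other points the value is the junk value `x`. -/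
def That (α : FrequencyVector d) (C C' : ℝ) (x : onePerp d) : onePerp d :=
  if h : (Finset.univ.filter fun i => x ∈ α.S C C' i).Nonempty then
    x + α.step ((Finset.univ.filter fun i => x ∈ α.S C C' i).min' h)
  else x

/-- `(α, C, C', x₀)` are Tijdeman parameters. -/
structure IsTijdemanParameters (α : FrequencyVector d) (C C' : ℝ) (x₀ : onePerp d) : Prop where
  totallyIrrational : α.TotallyIrrational
  C_nonneg : 0 ≤ C
  le_C' : 1 - 1 / (d : ℝ) ≤ C'
  orbit_mem : ∀ (n : ℕ) (i : Fin d),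
    ((α.That C C')^[n] x₀).1 i ∈ Icc (-C') C

/-- The orbit closure `D_{α,C,C'}` of the origin. -/
def D (α : FrequencyVector d) (C C' : ℝ) : Set (onePerp d) :=
  closure (range fun n : ℕ => (α.That C C')^[n] 0)

/-- The closure `P_{α,C,C'}` of the interior of the orbit closure. -/
def P (α : FrequencyVector d) (C C' : ℝ) : Set (onePerp d) :=
  closure (interior (α.D C C'))

/-- The pieces `P_{α,C,C',i}`. -/
def piece (α : FrequencyVector d) (C C' : ℝ) (i : Fin d) : Set (onePerp d) :=
  closure (interior (α.P C C') ∩ interior (α.S C C' i))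

end FrequencyVector

end

/-! Every branch of `That` adds some `α.step i`, and these vectors differ by elements of Λ. Modulo Λ
the map is therefore a single translation, minimal by Kronecker's theorem. The orbit closure `D` of
the origin is compact and lies in the box [-C', C]^d, so it meets every class modulo Λ. As C, C' <
1, the points near 0 (`originCell`) are the only representatives of their classes in the box, so `D`
contains this neighbourhood.

The main point is that `D` has essentially one point in each class. The sets `D ∩ region i` are
disjoint in `D`, while their translates by `step i` cover `D` up to a null set; comparing measures,
these translates overlap in null sets (`leb_overlap`). A point is generic if its class modulo a
countable group avoids the walls and the overlaps. Almost every point is generic, and `That` is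
injective on the generic points of `D`. Two such points in one class enter the origin cell at a
common time, coincide there, and hence were equal (`injOn_toTorus`).

By compactness of the torus, finitely many iteration times suffice to reach every class from the
origin cell. Every generic point of `D` is thus an image of the cell after boundedly many steps.
Cutting along the cells of `That` at each step shows that, up to nongeneric points, `D` is a finite
union of open polyhedra (`exists_polyhedra`), and `P` is the closure of that union. The five claims
follow, with `toTorus` on the generic points of `D` as the conjugacy. -/

/-! Open polyhedra. -/

section Polyhedra

variable {V : Type*} [NormedAddCommGroup V] [NormedSpace ℝ V]

/-- An open polyhedron: a finite intersection of open half-spaces. -/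
def IsOpenPolyhedron (A : Set V) : Prop :=
  ∃ s : Finset ((V →L[ℝ] ℝ) × ℝ), A = {x | ∀ p ∈ s, p.1 x < p.2}

theorem IsOpenPolyhedron.halfSpace (f : V →L[ℝ] ℝ) (c : ℝ) : IsOpenPolyhedron {x | f x < c} :=
  ⟨{(f, c)}, by simp⟩

theorem IsOpenPolyhedron.univ : IsOpenPolyhedron (univ : Set V) :=
  ⟨∅, by simp⟩

theorem IsOpenPolyhedron.inter {A B : Set V} (hA : IsOpenPolyhedron A) (hB : IsOpenPolyhedron B) :
    IsOpenPolyhedron (A ∩ B) := by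
  classical
  obtain ⟨s, rfl⟩ := hA
  obtain ⟨t, rfl⟩ := hB
  refine ⟨s ∪ t, ?_⟩
  ext x
  simp only [mem_inter_iff, mem_ofPred_eq, Finset.mem_union]
  exact ⟨fun h p hp => hp.elim (h.1 p) (h.2 p), fun h => ⟨fun p hp => h p (.inl hp),
    fun p hp => h p (.inr hp)⟩⟩

theorem IsOpenPolyhedron.iInter {ι : Type*} [Finite ι] {A : ι → Set V}
    (hA : ∀ i, IsOpenPolyhedron (A i)) : IsOpenPolyhedron (⋂ i, A i) := by
  classical
  have := Fintype.ofFinite ι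
  choose s hs using hA
  refine ⟨Finset.univ.biUnion s, ?_⟩
  ext x
  simp only [mem_iInter, mem_ofPred_eq, Finset.mem_biUnion, Finset.mem_univ, true_and]
  constructor
  · rintro h p ⟨i, hi⟩
    have := h i
    rw [hs i] at this
    exact this p hi
  · intro h i
    rw [hs i]
    exact fun p hp => h p ⟨i, hp⟩

theorem IsOpenPolyhedron.vadd {A : Set V} (hA : IsOpenPolyhedron A) (v : V) :
    IsOpenPolyhedron (v +ᵥ A) := by
  classical
  obtain ⟨s, rfl⟩ := hA
  refine ⟨s.image fun p => (p.1, p.2 + p.1 v), ?_⟩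
  ext x
  simp only [mem_vadd_set_iff_neg_vadd_mem, mem_ofPred_eq, Finset.mem_image, vadd_eq_add]
  constructor
  · rintro h _ ⟨p, hp, rfl⟩
    have := h p hp
    simp only [map_add, map_neg] at this ⊢
    linarith
  · intro h p hp
    have := h _ ⟨p, hp, rfl⟩
    simp only [map_add, map_neg] at this ⊢
    linarith

theorem IsOpenPolyhedron.isOpen {A : Set V} (hA : IsOpenPolyhedron A) : IsOpen A := by
  obtain ⟨s, rfl⟩ := hA
  have : {x : V | ∀ p ∈ s, p.1 x < p.2} = ⋂ p ∈ s, {x | p.1 x < p.2} := by ext; simp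
  rw [this]
  exact isOpen_biInter_finset fun p _ => isOpen_lt p.1.continuous continuous_const

theorem IsOpenPolyhedron.convex {A : Set V} (hA : IsOpenPolyhedron A) : Convex ℝ A := by
  obtain ⟨s, rfl⟩ := hA
  have : {x : V | ∀ p ∈ s, p.1 x < p.2} = ⋂ p ∈ s, {x | p.1 x < p.2} := by ext; simp
  rw [this]
  exact convex_iInter₂ fun p _ => convex_halfSpace_lt p.1.toLinearMap.isLinear _

/-- Moving a solution of the weak inequalities slightly towards a solution of the strict ones makes
all of them strict. Without `hne` the weak system could be solvable while the strict one is not. -/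
theorem closure_openPolyhedron (s : Finset ((V →L[ℝ] ℝ) × ℝ))
    (hne : {x : V | ∀ p ∈ s, p.1 x < p.2}.Nonempty) :
    closure {x : V | ∀ p ∈ s, p.1 x < p.2} = {x | ∀ p ∈ s, p.1 x ≤ p.2} := by
  apply Subset.antisymm
  · apply closure_minimal fun x hx p hp => (hx p hp).le
    have : {x : V | ∀ p ∈ s, p.1 x ≤ p.2} = ⋂ p ∈ s, {x | p.1 x ≤ p.2} := by ext; simp
    rw [this]
    exact isClosed_biInter fun p _ => isClosed_le p.1.continuous continuous_const
  · intro x hx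
    obtain ⟨y, hy⟩ := hne
    have ht : Tendsto (fun t : ℝ => x + t • (y - x)) (𝓝[>] 0) (𝓝 x) := by
      have : Continuous fun t : ℝ => x + t • (y - x) := by fun_prop
      simpa using (this.tendsto 0).mono_left nhdsWithin_le_nhds
    refine mem_closure_of_tendsto ht ?_
    filter_upwards [Ioo_mem_nhdsGT (zero_lt_one (α := ℝ))] with t ht p hp
    have h1 := hx p hp
    have h2 := hy p hp
    simp only [map_add, map_smul, map_sub, smul_eq_mul]
    nlinarith [ht.1, ht.2]

/-- The extreme points of a closed polyhedron are determined by their active constraints. -/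
theorem finite_extremePoints_polyhedron (s : Finset ((V →L[ℝ] ℝ) × ℝ)) :
    (extremePoints ℝ {x : V | ∀ p ∈ s, p.1 x ≤ p.2}).Finite := by
  classical
  refine Set.Finite.of_finite_image (f := fun x : V => s.filter fun p => p.1 x = p.2)
    ((s.powerset.finite_toSet).subset ?_) ?_
  · rintro _ ⟨x, -, rfl⟩
    exact Finset.mem_powerset.2 (Finset.filter_subset _ _)
  · intro x hx y hy hxy
    by_contra hne
    have hact : ∀ p ∈ s, (p.1 x = p.2 ↔ p.1 y = p.2) := by
      intro p hp
      have := Finset.ext_iff.1 hxy p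
      simpa [hp] using this
    -- Along the line through `x` and `y` the common active constraints stay equalities, and the
    -- others stay strict near `x`. So the polyhedron contains a segment with midpoint `x`, against
    -- extremality.
    have hev : ∀ᶠ t : ℝ in 𝓝 0, ∀ p ∈ s, p.1 (x + t • (y - x)) ≤ p.2 := by
      rw [Finset.eventually_all]
      intro p hp
      by_cases h : p.1 x = p.2
      · refine Eventually.of_forall fun t => ?_
        simp [h, (hact p hp).1 h]
      · have hlt : p.1 x < p.2 := lt_of_le_of_ne (hx.1 p hp) h
        have hc : Continuous fun t : ℝ => p.1 (x + t • (y - x)) := by fun_prop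
        have := hc.tendsto 0
        simp only [zero_smul, add_zero] at this
        exact (this.eventually (gt_mem_nhds hlt)).mono fun t ht => ht.le
    obtain ⟨ε, hε, hball⟩ := Metric.eventually_nhds_iff.1 hev
    have hp : x + (ε / 2) • (y - x) ∈ {x : V | ∀ p ∈ s, p.1 x ≤ p.2} :=
      hball (by simp [abs_of_pos hε]; linarith)
    have hm : x + (-(ε / 2)) • (y - x) ∈ {x : V | ∀ p ∈ s, p.1 x ≤ p.2} :=
      hball (by simp [abs_of_pos hε]; linarith)
    have hseg : x ∈ openSegment ℝ (x + (ε / 2) • (y - x)) (x + (-(ε / 2)) • (y - x)) :=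
      ⟨1 / 2, 1 / 2, by norm_num, by norm_num, by norm_num, by module⟩
    have := hx.2 hp hm hseg
    have h0 : (ε / 2) • (y - x) = 0 := by simpa using this
    rcases smul_eq_zero.1 h0 with h | h
    · linarith
    · exact hne (sub_eq_zero.1 h).symm

/-- By Krein–Milman the closure is the closed convex hull of its extreme points; these are finite in
number, so their convex hull is already closed. -/
theorem IsOpenPolyhedron.isConvexPolytope_closure [FiniteDimensional ℝ V] {A : Set V}
    (hA : IsOpenPolyhedron A) (hne : A.Nonempty) (hb : Bornology.IsBounded A) :
    IsConvexPolytope (closure A) := by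
  have : ProperSpace V := FiniteDimensional.proper_real V
  have hconv := hA.convex.closure
  have hcomp : IsCompact (closure A) := hb.isCompact_closure
  obtain ⟨s, rfl⟩ := hA
  have hfin : (extremePoints ℝ (closure {x : V | ∀ p ∈ s, p.1 x < p.2})).Finite := by
    rw [closure_openPolyhedron s hne]
    exact finite_extremePoints_polyhedron s
  refine ⟨_, hfin, ?_⟩
  rw [← hfin.isCompact_convexHull ℝ |>.isClosed.closure_eq,
    closure_convexHull_extremePoints hcomp hconv]

end Polyhedra

/-! Kronecker's theorem, by averaging characters. -/

section Kronecker

variable {ι : Type*} [Fintype ι]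

instance UnitAddCircle.isProbabilityMeasure_volume :
    IsProbabilityMeasure (volume : Measure UnitAddCircle) :=
  ⟨UnitAddCircle.measure_univ⟩

theorem UnitAddTorus.mFourier_apply_add (n : ι → ℤ) (x y : UnitAddTorus ι) :
    mFourier n (x + y) = mFourier n x * mFourier n y := by
  simp [mFourier, fourier_apply, Finset.prod_mul_distrib, AddCircle.toCircle_add, smul_add]

theorem UnitAddTorus.mFourier_apply_nsmul (n : ι → ℤ) (x : UnitAddTorus ι) (k : ℕ) :
    mFourier n (k • x) = mFourier n x ^ k := by
  induction k with
  | zero => simp [mFourier]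
  | succ k ih => rw [succ_nsmul, mFourier_apply_add, ih, pow_succ]

theorem tendsto_average_pow_of_norm_eq_one {z : ℂ} (hz : ‖z‖ = 1) (hz1 : z ≠ 1) :
    Tendsto (fun N : ℕ => (N : ℂ)⁻¹ * ∑ k ∈ Finset.range N, z ^ k) atTop (𝓝 0) := by
  have hb : ∀ N : ℕ, ‖(N : ℂ)⁻¹ * ∑ k ∈ Finset.range N, z ^ k‖ ≤ (N : ℝ)⁻¹ * (2 / ‖z - 1‖) := by
    intro N
    rw [norm_mul, norm_inv, Complex.norm_natCast, geom_sum_eq hz1, norm_div]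
    gcongr
    refine (norm_sub_le _ _).trans ?_
    simp [hz]
    norm_num
  refine squeeze_zero_norm hb ?_
  simpa using (tendsto_inv_atTop_nhds_zero_nat (𝕜 := ℝ)).mul_const (2 / ‖z - 1‖)

/-- Kronecker's theorem: the forward orbit of `0` under a translation on which no nontrivial
character is trivial is dense in the torus. -/
theorem UnitAddTorus.denseRange_nsmul (a : UnitAddTorus ι)
    (ha : ∀ n : ι → ℤ, n ≠ 0 → mFourier n a ≠ 1) : DenseRange fun k : ℕ => k • a := by
  classical
  have hnorm1 : ∀ n : ι → ℤ, ‖mFourier n a‖ = 1 := by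
    intro n
    simp only [mFourier, fourier_apply, ContinuousMap.coe_mk, norm_prod, Circle.norm_coe,
      Finset.prod_const_one]
  -- The orbit averages of every continuous function converge to its Haar integral. Both functionals
  -- are 1-Lipschitz in the sup norm, so characters suffice.
  let avg : ℕ → C(UnitAddTorus ι, ℂ) → ℂ :=
    fun N f => (N : ℂ)⁻¹ * ∑ k ∈ Finset.range N, f (k • a)
  have hcoeff : ∀ n : ι → ℤ, n ≠ 0 → Tendsto (fun N => avg N (mFourier n)) atTop (𝓝 0) := by
    intro n hn
    simpa only [avg, mFourier_apply_nsmul] using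
      tendsto_average_pow_of_norm_eq_one (hnorm1 n) (ha n hn)
  have havg_sub : ∀ N f g, ‖avg N f - avg N g‖ ≤ ‖f - g‖ := by
    intro N f g
    rcases Nat.eq_zero_or_pos N with rfl | hN
    · simp [avg]
    have hN' : (0 : ℝ) < N := by exact_mod_cast hN
    rw [← mul_sub, ← Finset.sum_sub_distrib, norm_mul, norm_inv, Complex.norm_natCast]
    calc (N : ℝ)⁻¹ * ‖∑ k ∈ Finset.range N, (f (k • a) - g (k • a))‖
        ≤ (N : ℝ)⁻¹ * ∑ k ∈ Finset.range N, ‖f - g‖ := by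
          gcongr
          refine norm_sum_le_of_le _ fun k _ => ?_
          exact (f - g).norm_coe_le_norm (k • a)
      _ = ‖f - g‖ := by simp [hN'.ne']
  let I : C(UnitAddTorus ι, ℂ) → ℂ := fun f => ∫ x, f x
  have hint : ∀ f : C(UnitAddTorus ι, ℂ), Integrable f (volume : Measure (UnitAddTorus ι)) :=
    fun f => f.continuous.integrable_of_hasCompactSupport (HasCompactSupport.of_compactSpace _)
  have hI_sub : ∀ f g, ‖I f - I g‖ ≤ ‖f - g‖ := by
    intro f g
    rw [← integral_sub (hint f) (hint g)]
    refine (norm_integral_le_of_norm_le_const (C := ‖f - g‖)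
      (Eventually.of_forall fun x => (f - g).norm_coe_le_norm x)).trans ?_
    simp
  have hmain : ∀ f, Tendsto (fun N => avg N f) atTop (𝓝 (I f)) := by
    have hspan : ∀ g ∈ Submodule.span ℂ (range (mFourier (d := ι))),
        Tendsto (fun N => avg N g) atTop (𝓝 (I g)) := by
      intro g hg
      induction hg using Submodule.span_induction with
      | mem g hg =>
        obtain ⟨n, rfl⟩ := hg
        by_cases hn : n = 0
        · subst hn
          have hIone : I (mFourier 0) = 1 := by simp [I, mFourier_zero]
          rw [hIone]
          refine tendsto_const_nhds.congr' ?_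
          filter_upwards [eventually_gt_atTop 0] with N hN
          have : (N : ℂ) ≠ 0 := by exact_mod_cast hN.ne'
          simp [avg, mFourier_zero, this]
        · have hIzero : I (mFourier n) = 0 := by
            -- Invariance of Haar measure under translation by `a` forces the integral of a
            -- nontrivial character to vanish.
            have h1 : I (mFourier n) = mFourier n a * I (mFourier n) := by
              simp only [I]
              rw [← integral_const_mul]
              conv_lhs => rw [← integral_add_left_eq_self _ a]
              simp only [mFourier_apply_add]
            have h2 : (mFourier n a - 1) * I (mFourier n) = 0 := by
              rw [sub_mul, ← h1]; ring
            exact (mul_eq_zero.1 h2).resolve_left (sub_ne_zero.2 (ha n hn))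
          rw [hIzero]
          exact hcoeff n hn
      | zero => simp [avg, I]
      | add f g _ _ hf hg =>
        have : I (f + g) = I f + I g := integral_add (hint f) (hint g)
        rw [this]
        refine (hf.add hg).congr fun N => ?_
        simp [avg, Finset.sum_add_distrib, mul_add]
      | smul c f _ hf =>
        have : I (c • f) = c * I f := integral_const_mul c _
        rw [this]
        refine (hf.const_mul c).congr fun N => ?_
        simp only [avg, ContinuousMap.smul_apply, smul_eq_mul, ← Finset.mul_sum]
        ring
    intro f
    rw [Metric.tendsto_atTop]
    intro ε hε
    have hf : f ∈ closure (Submodule.span ℂ (range (mFourier (d := ι))) : Set _) := by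
      have := span_mFourier_closure_eq_top (d := ι)
      rw [← Submodule.topologicalClosure_coe, this]
      trivial
    obtain ⟨g, hg, hfg⟩ := Metric.mem_closure_iff.1 hf (ε / 4) (by linarith)
    obtain ⟨N₀, hN₀⟩ := Metric.tendsto_atTop.1 (hspan g hg) (ε / 4) (by linarith)
    refine ⟨N₀, fun N hN => ?_⟩
    have h1 := havg_sub N f g
    have h2 := hI_sub f g
    have h3 := hN₀ N hN
    rw [dist_eq_norm] at hfg h3 ⊢
    have : avg N f - I f = (avg N f - avg N g) + (avg N g - I g) - (I f - I g) := by ring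
    rw [this]
    have h4 := norm_sub_le ((avg N f - avg N g) + (avg N g - I g)) (I f - I g)
    have h5 := norm_add_le (avg N f - avg N g) (avg N g - I g)
    linarith
  by_contra hnd
  rw [DenseRange, Dense] at hnd
  push Not at hnd
  obtain ⟨y, hy⟩ := hnd
  -- A Urysohn function vanishing on the orbit closure has zero averages but a positive integral.
  obtain ⟨f, hf0, hf1, hf⟩ := exists_continuous_zero_one_of_isClosed
    (isClosed_closure (s := range fun k : ℕ => k • a)) (isClosed_singleton (x := y))
    (disjoint_singleton_right.2 hy)
  let F : C(UnitAddTorus ι, ℂ) := ⟨fun x => (f x : ℂ), by fun_prop⟩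
  have hF0 : ∀ N, avg N F = 0 := by
    intro N
    have : ∀ k : ℕ, F (k • a) = 0 := fun k => by
      have := hf0 (subset_closure (mem_range_self (f := fun k : ℕ => k • a) k))
      simpa [F] using this
    simp [avg, this]
  have hIF : I F = 0 := by
    have := hmain F
    simp only [hF0] at this
    exact tendsto_nhds_unique this tendsto_const_nhds
  have hIf : I F = ((∫ x, f x : ℝ) : ℂ) := integral_ofReal
  have hpos : 0 < ∫ x, f x := by
    refine Continuous.integral_pos_of_hasCompactSupport_nonneg_nonzero f.continuous
      (HasCompactSupport.of_compactSpace _) (fun x => (hf x).1) (x := y) ?_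
    rw [hf1 rfl]; simp
  rw [hIF] at hIf
  exact hpos.ne' (by exact_mod_cast hIf.symm)

end Kronecker

/-! The projection of `1^⊥` onto the torus. -/

section Projection

variable {d : ℕ}

@[ext]
theorem onePerp.ext {x y : onePerp d} (h : ∀ i, x.1 i = y.1 i) : x = y :=
  Subtype.ext (funext h)

theorem onePerp.sum_eq_zero (x : onePerp d) : ∑ i, x.1 i = 0 := x.2

/-- The `i`-th coordinate as a functional on `1^⊥`. -/
def onePerp.coordL (i : Fin d) : onePerp d →L[ℝ] ℝ :=
  (ContinuousLinearMap.proj i).comp (onePerp d).subtypeL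

@[simp]
theorem onePerp.coordL_apply (i : Fin d) (x : onePerp d) : onePerp.coordL i x = x.1 i := rfl

theorem onePerp.continuous_coord (i : Fin d) : Continuous fun x : onePerp d => x.1 i :=
  (onePerp.coordL i).continuous

theorem mem_onePerpLattice {x : onePerp d} :
    x ∈ onePerpLattice d ↔ ∀ i, ∃ n : ℤ, x.1 i = n := Iff.rfl

/-- The first `d - 1` coordinates. -/
def onePerp.initCoords (d : ℕ) : onePerp d →ₗ[ℝ] (Fin (d - 1) → ℝ) :=
  (LinearMap.funLeft ℝ ℝ (Fin.castLE (Nat.sub_le d 1))).comp (onePerp d).subtype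

theorem onePerp.initCoords_surjective : Function.Surjective (onePerp.initCoords d) := by
  intro y
  rcases d with _ | n
  · exact ⟨0, funext fun k => k.elim0⟩
  · refine ⟨⟨Fin.snoc (α := fun _ => ℝ) y (-∑ k, y k), ?_⟩, ?_⟩
    · change ∑ i, _ = _
      rw [Fin.sum_univ_castSucc]
      simp
    · funext k
      exact Fin.snoc_castSucc (α := fun _ => ℝ) _ _ k

/-- The projection `1^⊥ → 𝕋^{d-1}` given by the first `d - 1` coordinates. -/
def toTorus (d : ℕ) : onePerp d →+ UnitAddTorus (Fin (d - 1)) where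
  toFun x k := (onePerp.initCoords d x k : UnitAddCircle)
  map_zero' := by ext; simp
  map_add' x y := by ext; simp

theorem toTorus_apply (x : onePerp d) (k : Fin (d - 1)) :
    toTorus d x k = (x.1 (Fin.castLE (Nat.sub_le d 1) k) : UnitAddCircle) := rfl

theorem continuous_toTorus : Continuous (toTorus d) := by
  refine continuous_pi fun k => ?_
  exact (AddCircle.continuous_mk' (1 : ℝ)).comp (onePerp.continuous_coord _)

theorem isOpenMap_toTorus : IsOpenMap (toTorus d) := by
  have h1 : IsOpenMap (onePerp.initCoords d) :=
    LinearMap.isOpenMap_of_finiteDimensional _ onePerp.initCoords_surjective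
  have h2 : IsOpenMap (Pi.map fun (_ : Fin (d - 1)) (x : ℝ) => (x : UnitAddCircle)) :=
    IsOpenMap.piMap (fun _ => QuotientAddGroup.isOpenMap_coe)
      (by simp)
  exact h2.comp h1

theorem toTorus_surjective : Function.Surjective (toTorus d) := by
  intro y
  choose z hz using fun k => QuotientAddGroup.mk_surjective (y k)
  obtain ⟨x, hx⟩ := onePerp.initCoords_surjective z
  exact ⟨x, funext fun k => by rw [← hz k, ← hx]; rfl⟩

theorem UnitAddCircle.coe_eq_zero_iff_int {x : ℝ} : (x : UnitAddCircle) = 0 ↔ ∃ n : ℤ, x = n := by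
  rw [AddCircle.coe_eq_zero_iff]
  simp [eq_comm]

/-- Since the coordinates sum to zero, integrality of the first `d - 1` forces that of the last. So
`toTorus` identifies the quotient by Λ with the torus. -/
theorem toTorus_eq_zero_iff {x : onePerp d} : toTorus d x = 0 ↔ x ∈ onePerpLattice d := by
  rw [mem_onePerpLattice, funext_iff]
  simp only [toTorus_apply, Pi.zero_apply, UnitAddCircle.coe_eq_zero_iff_int]
  constructor
  · intro h
    rcases d with _ | n
    · exact fun i => i.elim0
    · obtain ⟨m, hm⟩ : ∃ m : Fin n → ℤ, ∀ k : Fin n, x.1 k.castSucc = m k :=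
        ⟨fun k => (h k).choose, fun k => (h k).choose_spec⟩
      intro i
      induction i using Fin.lastCases with
      | last =>
        refine ⟨-∑ k, m k, ?_⟩
        have := onePerp.sum_eq_zero x
        rw [Fin.sum_univ_castSucc] at this
        simp only [hm] at this
        push_cast
        linarith
      | cast k => exact ⟨_, hm k⟩
  · exact fun h k => h _

theorem toTorus_eq_iff {x y : onePerp d} : toTorus d x = toTorus d y ↔ x - y ∈ onePerpLattice d := by
  rw [← toTorus_eq_zero_iff, map_sub, sub_eq_zero]

end Projection

/-! ### Total irrationality and minimality of the translation. -/

namespace FrequencyVector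

variable {d : ℕ} (α : FrequencyVector d)

theorem step_apply (i j : Fin d) :
    (α.step i).1 j = α.coord j - (Pi.single i 1 : Fin d → ℝ) j := rfl

/-- This is why all branches of `That` induce the same translation of the torus. -/
theorem step_sub_step_mem (i j : Fin d) : α.step i - α.step j ∈ onePerpLattice d := by
  intro k
  refine ⟨(Pi.single j 1 : Fin d → ℤ) k - (Pi.single i 1 : Fin d → ℤ) k, ?_⟩
  change (α.step i).1 k - (α.step j).1 k = _
  rw [step_apply, step_apply]
  by_cases h : k = i <;> by_cases h' : k = j <;> simp [Pi.single_apply, h, h']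

theorem torusTranslation_toTorus (i : Fin d) (x : onePerp d) :
    α.torusTranslation (toTorus d x) = toTorus d (x + α.step i) := by
  funext k
  rw [toTorus_apply]
  change ((x.1 _ : ℝ) : UnitAddCircle) + ((α.coord _ : ℝ) : UnitAddCircle) =
    ((x.1 _ + (α.step i).1 _ : ℝ) : UnitAddCircle)
  rw [step_apply, ← AddCircle.coe_add, ← sub_eq_zero, ← AddCircle.coe_sub,
    UnitAddCircle.coe_eq_zero_iff_int]
  refine ⟨(Pi.single i 1 : Fin d → ℤ) (Fin.castLE (Nat.sub_le d 1) k), ?_⟩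
  by_cases h : Fin.castLE (Nat.sub_le d 1) k = i <;> simp [h]

/-- The translation vector on the torus. -/
def torusVector : UnitAddTorus (Fin (d - 1)) := toTorus d (α.step α.last)

theorem toTorus_step (i : Fin d) : toTorus d (α.step i) = α.torusVector :=
  toTorus_eq_iff.2 (α.step_sub_step_mem i α.last)

theorem torusTranslation_eq (x : UnitAddTorus (Fin (d - 1))) :
    α.torusTranslation x = x + α.torusVector := by
  obtain ⟨y, rfl⟩ := toTorus_surjective x
  rw [α.torusTranslation_toTorus α.last, map_add]
  rfl

variable {α}

theorem TotallyIrrational.mFourier_torusVector_ne_one (hα : α.TotallyIrrational)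
    (n : Fin (d - 1) → ℤ) (hn : n ≠ 0) : UnitAddTorus.mFourier n α.torusVector ≠ 1 := by
  obtain ⟨m, rfl⟩ : ∃ m, d = m + 1 := ⟨d - 1, by have := α.card_pos; omega⟩
  intro h
  have hv : ∀ k : Fin m, α.torusVector k = ((α.coord k.castSucc : ℝ) : UnitAddCircle) := by
    intro k
    have := congrFun (α.torusTranslation_eq 0) k
    rw [zero_add] at this
    rw [← this]
    exact zero_add _
  have h1 : UnitAddTorus.mFourier n α.torusVector =
      (AddCircle.toCircle ((∑ k : Fin m, n k * α.coord k.castSucc : ℝ) : UnitAddCircle) : ℂ) := by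
    have h2 : ((∑ k : Fin m, n k * α.coord k.castSucc : ℝ) : UnitAddCircle) =
        ∑ k : Fin m, n k • α.torusVector k := by
      simp only [hv, ← AddCircle.coe_zsmul, zsmul_eq_mul]
      exact map_sum (QuotientAddGroup.mk' (AddSubgroup.zmultiples (1 : ℝ))) _ _
    rw [h2]
    have h3 : ∀ s : Finset (Fin m), (AddCircle.toCircle (∑ k ∈ s, n k • α.torusVector k) : ℂ) =
        ∏ k ∈ s, (AddCircle.toCircle (n k • α.torusVector k) : ℂ) := by
      intro s
      induction s using Finset.cons_induction with
      | empty => simp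
      | cons a s ha ih => rw [Finset.sum_cons, Finset.prod_cons, AddCircle.toCircle_add, ← ih]; rfl
    rw [h3]
    simp only [UnitAddTorus.mFourier, fourier_apply, ContinuousMap.coe_mk]
    rfl
  rw [h1] at h
  have h4 : ((∑ k : Fin m, n k * α.coord k.castSucc : ℝ) : UnitAddCircle) = 0 := by
    apply AddCircle.injective_toCircle one_ne_zero
    rw [AddCircle.toCircle_zero]
    exact Subtype.ext h
  obtain ⟨l, hl⟩ := UnitAddCircle.coe_eq_zero_iff_int.1 h4
  -- A trivial character gives ∑ n_k α_k = l with l an integer. Writing l as l ∑ α_i turns this into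
  -- a homogeneous rational relation, with coefficients n_k - l and, at the last index, -l.
  let g : Fin (m + 1) → ℚ := Fin.snoc (α := fun _ => ℚ) (fun k => (n k : ℚ) - l) (-l)
  have hg : ∑ i, g i • α.coord i = 0 := by
    have hs := α.sum_eq_one
    rw [Fin.sum_univ_castSucc] at hs ⊢
    simp only [g, Fin.snoc_castSucc, Fin.snoc_last, Rat.smul_def]
    push_cast
    simp only [sub_mul, Finset.sum_sub_distrib, ← Finset.mul_sum]
    rw [hl]
    linear_combination (-(l : ℝ)) * hs
  have h0 := Fintype.linearIndependent_iff.1 hα g hg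
  have hl0 : (l : ℚ) = 0 := by simpa [g] using h0 (Fin.last m)
  refine hn (funext fun k => ?_)
  have := h0 k.castSucc
  simp only [g, Fin.snoc_castSucc, hl0, sub_zero] at this
  exact_mod_cast this

theorem TotallyIrrational.denseRange_torusVector (hα : α.TotallyIrrational) :
    DenseRange fun k : ℕ => k • α.torusVector :=
  UnitAddTorus.denseRange_nsmul _ hα.mFourier_torusVector_ne_one

/-- Forward orbits modulo the lattice meet every nonempty open set. -/
theorem TotallyIrrational.exists_nsmul_mem (hα : α.TotallyIrrational) (x : onePerp d)
    {U : Set (onePerp d)} (hU : IsOpen U) (hne : U.Nonempty) :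
    ∃ k : ℕ, ∃ u ∈ U, toTorus d u = toTorus d x + k • α.torusVector := by
  have hopen : IsOpen ((fun y => toTorus d x + y) ⁻¹' (toTorus d '' U)) :=
    (isOpenMap_toTorus _ hU).preimage (continuous_const.add continuous_id)
  have hne' : ((fun y => toTorus d x + y) ⁻¹' (toTorus d '' U)).Nonempty := by
    obtain ⟨u, hu⟩ := hne
    exact ⟨toTorus d u - toTorus d x, u, hu, by simp⟩
  obtain ⟨k, u, hu, hk⟩ := hα.denseRange_torusVector.exists_mem_open hopen hne'
  exact ⟨k, u, hu, hk⟩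

theorem TotallyIrrational.isMinimalTranslation (hα : α.TotallyIrrational) :
    IsMinimalTranslation (onePerpLattice d) (α.step α.last) := by
  intro x
  obtain ⟨x, rfl⟩ := QuotientAddGroup.mk_surjective x
  rw [dense_iff_inter_open]
  intro U hU hne
  obtain ⟨k, u, hu, hk⟩ := hα.exists_nsmul_mem x (hU.preimage QuotientAddGroup.continuous_mk)
    (by obtain ⟨y, hy⟩ := hne
        obtain ⟨y, rfl⟩ := QuotientAddGroup.mk_surjective y
        exact ⟨y, hy⟩)
  refine ⟨_, hu, k, ?_⟩
  have hit : ∀ k : ℕ, (fun y : onePerp d ⧸ onePerpLattice d =>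
      y + (α.step α.last : onePerp d ⧸ onePerpLattice d))^[k] (x : onePerp d ⧸ onePerpLattice d) =
      ((x + k • α.step α.last : onePerp d) : onePerp d ⧸ onePerpLattice d) := by
    intro k
    induction k with
    | zero => simp
    | succ k ih =>
      rw [Function.iterate_succ_apply', ih, succ_nsmul, ← add_assoc]
      rfl
  refine (hit k).trans ?_
  rw [QuotientAddGroup.eq, neg_add_eq_sub, ← toTorus_eq_iff, hk, map_add, map_nsmul]
  rfl

end FrequencyVector

/-! Measure theory and geometry of the cells on which `T̂` is a translation. -/

instance (d : ℕ) : (lebOnePerp d).IsAddHaarMeasure :=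
  inferInstanceAs (Measure.addHaar : Measure (onePerp d)).IsAddHaarMeasure

section Polyhedra

variable {V : Type*} [NormedAddCommGroup V] [NormedSpace ℝ V]

theorem IsOpenPolyhedron.forall_imp {ι : Type*} [Finite ι] (Q : ι → Prop) {A : ι → Set V}
    (hA : ∀ i, IsOpenPolyhedron (A i)) : IsOpenPolyhedron {x | ∀ i, Q i → x ∈ A i} := by
  classical
  have h : {x | ∀ i, Q i → x ∈ A i} = ⋂ i, if Q i then A i else Set.univ := by
    ext x
    simp only [mem_ofPred_eq, mem_iInter]
    refine forall_congr' fun i => ?_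
    by_cases hi : Q i <;> simp [hi]
  rw [h]
  refine .iInter fun i => ?_
  split_ifs
  exacts [hA i, .univ]

theorem addHaar_level_set [FiniteDimensional ℝ V] [MeasurableSpace V] [BorelSpace V] (μ : Measure V)
    [μ.IsAddHaarMeasure] {f : V →L[ℝ] ℝ} (hf : f ≠ 0) (c : ℝ) : μ {x | f x = c} = 0 := by
  rcases Set.eq_empty_or_nonempty {x | f x = c} with h | ⟨x₀, hx₀⟩
  · rw [h, measure_empty]
  · have hs : {x | f x = c} = (AffineSubspace.mk' x₀ (LinearMap.ker f.toLinearMap) : Set V) := by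
      ext x
      simp only [mem_ofPred_eq, SetLike.mem_coe, AffineSubspace.mem_mk', LinearMap.mem_ker,
        vsub_eq_sub] at hx₀ ⊢
      simp [hx₀, sub_eq_zero]
    rw [hs]
    refine Measure.addHaar_affineSubspace μ _ fun htop => hf ?_
    have h1 := congrArg AffineSubspace.direction htop
    rw [AffineSubspace.direction_mk', AffineSubspace.direction_top] at h1
    ext x
    exact LinearMap.mem_ker.1 (h1 ▸ Submodule.mem_top : x ∈ LinearMap.ker f.toLinearMap)

end Polyhedra

namespace FrequencyVector

variable {d : ℕ} (α : FrequencyVector d) (C C' : ℝ)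

theorem step_injective : Function.Injective α.step := by
  intro i j h
  by_contra hij
  have h1 := congrArg (fun x : onePerp d => x.1 i) h
  simp [step_apply, hij] at h1

theorem coordL_ne_zero (α : FrequencyVector d) (i : Fin d) : onePerp.coordL i ≠ 0 := by
  intro h
  have h1 := congrArg (fun f => f (α.step i)) h
  have h2 := α.lt_one i
  simp [step_apply] at h1
  linarith

/-- The functional whose level sets are the ties between `i` and `j`. -/
noncomputable def tieFunctional (i j : Fin d) : onePerp d →L[ℝ] ℝ :=
  (α.coord i)⁻¹ • onePerp.coordL i - (α.coord j)⁻¹ • onePerp.coordL j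

theorem tieFunctional_ne_zero {i j : Fin d} (hij : i ≠ j) : α.tieFunctional i j ≠ 0 := by
  intro h
  -- The value of the functional at `α.step i` is -1/α_i.
  have h1 := congrArg (fun f => f (α.step i)) h
  have hi := (α.pos i).ne'
  have hj := (α.pos j).ne'
  simp [tieFunctional, step_apply, hij.symm] at h1
  field_simp at h1
  linarith

theorem div_lt_div_iff_tie (i j : Fin d) (x : onePerp d) :
    (C - x.1 i) / α.coord i < (C - x.1 j) / α.coord j ↔
      α.tieFunctional j i x < C / α.coord j - C / α.coord i := by
  have hi := (α.pos i).ne'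
  have hj := (α.pos j).ne'
  simp only [tieFunctional, sub_apply, smul_apply,
    onePerp.coordL_apply, smul_eq_mul, div_eq_inv_mul]
  constructor <;> intro h <;> linarith

theorem div_eq_div_iff_tie (i j : Fin d) (x : onePerp d) :
    (C - x.1 i) / α.coord i = (C - x.1 j) / α.coord j ↔
      α.tieFunctional j i x = C / α.coord j - C / α.coord i := by
  simp only [tieFunctional, sub_apply, smul_apply,
    onePerp.coordL_apply, smul_eq_mul, div_eq_inv_mul]
  constructor <;> intro h <;> linarith

/-- The open cell where exactly the indices in `F` are feasible and `i` has strictly the earliest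
deadline. -/
def cell (κ : Finset (Fin d) × Fin d) : Set (onePerp d) :=
  {x | (∀ j, -C' < x.1 j) ∧ -C' < x.1 κ.2 + α.coord κ.2 - 1 ∧
    (∀ j, j ∈ κ.1 → -C' < x.1 j + α.coord j - 1) ∧ (∀ j, j ∉ κ.1 → x.1 j + α.coord j - 1 < -C') ∧
    ∀ j, j ∈ κ.1 ∧ j ≠ κ.2 → (C - x.1 κ.2) / α.coord κ.2 < (C - x.1 j) / α.coord j}

/-- Fixing the set of feasible indices turns the implication in `S` into a conjunction of strict
affine inequalities; `S` itself need not be convex. -/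
theorem isOpenPolyhedron_cell (κ : Finset (Fin d) × Fin d) :
    IsOpenPolyhedron (α.cell C C' κ) := by
  have hlow : ∀ (j : Fin d) (c : ℝ), IsOpenPolyhedron {x : onePerp d | c < x.1 j} := by
    intro j c
    convert IsOpenPolyhedron.halfSpace (-onePerp.coordL j) (-c) using 1
    ext x
    simp
  have hlow' : ∀ j : Fin d, IsOpenPolyhedron {x : onePerp d | -C' < x.1 j + α.coord j - 1} := by
    intro j
    convert hlow j (-C' - α.coord j + 1) using 1
    ext x
    simp only [mem_ofPred_eq]
    constructor <;> intro h <;> linarith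
  have hup : ∀ j : Fin d, IsOpenPolyhedron {x : onePerp d | x.1 j + α.coord j - 1 < -C'} := by
    intro j
    convert IsOpenPolyhedron.halfSpace (onePerp.coordL j) (-C' - α.coord j + 1) using 1
    ext x
    simp only [mem_ofPred_eq, onePerp.coordL_apply]
    constructor <;> intro h <;> linarith
  have htie : ∀ j : Fin d, IsOpenPolyhedron
      {x : onePerp d | (C - x.1 κ.2) / α.coord κ.2 < (C - x.1 j) / α.coord j} := by
    intro j
    simp only [div_lt_div_iff_tie]
    exact .halfSpace _ _
  have h1 := IsOpenPolyhedron.forall_imp (fun _ : Fin d => True) fun j => hlow j (-C')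
  have h2 := hlow' κ.2
  have h3 := IsOpenPolyhedron.forall_imp (fun j => j ∈ κ.1) hlow'
  have h4 := IsOpenPolyhedron.forall_imp (fun j => j ∉ κ.1) hup
  have h5 := IsOpenPolyhedron.forall_imp (fun j => j ∈ κ.1 ∧ j ≠ κ.2) htie
  convert h1.inter (h2.inter (h3.inter (h4.inter h5))) using 1
  ext x
  simp only [cell, mem_inter_iff, mem_ofPred_eq, true_imp_iff]

/-- The points where `i` is chosen, away from all walls. -/
def region (i : Fin d) : Set (onePerp d) := ⋃ F, α.cell C C' (F, i)

theorem isOpen_region (i : Fin d) : IsOpen (α.region C C' i) :=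
  isOpen_iUnion fun _ => (α.isOpenPolyhedron_cell C C' _).isOpen

variable {α C C'}

theorem region_subset_S (i : Fin d) : α.region C C' i ⊆ α.S C C' i := by
  rintro x hx
  obtain ⟨F, h1, h2, h3, h4, h5⟩ := mem_iUnion.1 hx
  refine ⟨fun j => (h1 j).le, h2.le, fun j hj => ?_⟩
  by_cases hji : j = i
  · rw [hji]
  by_cases hF : j ∈ F
  · exact (h5 j ⟨hF, hji⟩).le
  · exact absurd hj (not_le.2 (h4 j hF))

/-- Strictness rules out any competitor, so on the regions the choice of the smallest index plays no
role. -/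
theorem eq_of_mem_region_of_mem_S {x : onePerp d} {i j : Fin d} (hi : x ∈ α.region C C' i)
    (hj : x ∈ α.S C C' j) : j = i := by
  obtain ⟨F, h1, h2, h3, h4, h5⟩ := mem_iUnion.1 hi
  by_contra hji
  have hF : j ∈ F := by
    by_contra hF
    exact absurd hj.2.1 (not_le.2 (h4 j hF))
  exact absurd (h5 j ⟨hF, hji⟩) (not_lt.2 (hj.2.2 i h2.le))

theorem region_subset_interior_S (i : Fin d) : α.region C C' i ⊆ interior (α.S C C' i) :=
  interior_maximal (region_subset_S i) (α.isOpen_region C C' i)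

theorem region_disjoint {i j : Fin d} (hij : i ≠ j) :
    Disjoint (α.region C C' i) (α.region C C' j) :=
  Set.disjoint_left.2 fun _ hi hj => hij (eq_of_mem_region_of_mem_S hj (region_subset_S i hi))

theorem That_eq_of_nonempty {x : onePerp d} (h : ∃ i, x ∈ α.S C C' i) :
    ∃ i, x ∈ α.S C C' i ∧ α.That C C' x = x + α.step i := by
  classical
  have hne : (Finset.univ.filter fun i => x ∈ α.S C C' i).Nonempty := by
    obtain ⟨i, hi⟩ := h
    exact ⟨i, by simpa using hi⟩
  refine ⟨_, ?_, dif_pos hne⟩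
  exact (Finset.mem_filter.1 (Finset.min'_mem _ hne)).2

theorem That_eq_of_mem_region {x : onePerp d} {i : Fin d} (hx : x ∈ α.region C C' i) :
    α.That C C' x = x + α.step i := by
  obtain ⟨j, hj, h⟩ := That_eq_of_nonempty ⟨i, region_subset_S i hx⟩
  rw [h, eq_of_mem_region_of_mem_S hx hj]

/-- At every point of `1^⊥` some index is feasible. -/
theorem exists_feasible (hC' : 1 - 1 / (d : ℝ) ≤ C') (x : onePerp d) :
    ∃ i, -C' ≤ x.1 i + α.coord i - 1 := by
  by_contra! h
  have hd : (0 : ℝ) < d := by exact_mod_cast α.card_pos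
  have hne : (Finset.univ : Finset (Fin d)).Nonempty := ⟨⟨0, α.card_pos⟩, Finset.mem_univ _⟩
  -- Summing the failed inequalities over all indices gives 1 - d < -d C', contrary to C' ≥ 1 - 1/d.
  have h1 : ∑ i, (x.1 i + α.coord i - 1) < ∑ _i : Fin d, -C' :=
    Finset.sum_lt_sum_of_nonempty hne fun i _ => h i
  rw [Finset.sum_sub_distrib, Finset.sum_add_distrib, onePerp.sum_eq_zero, α.sum_eq_one] at h1
  simp only [Finset.sum_const, Finset.card_univ, Fintype.card_fin, nsmul_eq_mul] at h1
  have h2 : (d : ℝ) * (1 - 1 / d) ≤ d * C' := mul_le_mul_of_nonneg_left hC' hd.le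
  have h3 : (d : ℝ) * (1 - 1 / d) = d - 1 := by field_simp
  linarith

theorem exists_mem_S (hC' : 1 - 1 / (d : ℝ) ≤ C') {x : onePerp d} (hx : ∀ j, -C' ≤ x.1 j) :
    ∃ i, x ∈ α.S C C' i := by
  classical
  obtain ⟨i₀, hi₀⟩ := exists_feasible (α := α) hC' x
  obtain ⟨i, hi, hmin⟩ := Finset.exists_min_image
    (Finset.univ.filter fun i => -C' ≤ x.1 i + α.coord i - 1)
    (fun i => (C - x.1 i) / α.coord i) ⟨i₀, by simpa using hi₀⟩
  exact ⟨i, hx, (Finset.mem_filter.1 hi).2, fun j hj => hmin j (by simpa using hj)⟩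

variable (α C C') in
/-- The union of the walls between the cells. -/
def walls : Set (onePerp d) :=
  (⋃ j, {x | onePerp.coordL j x = -C'}) ∪ (⋃ j, {x | onePerp.coordL j x = 1 - α.coord j - C'}) ∪
    ⋃ i, ⋃ j, ⋃ _ : i ≠ j, {x | α.tieFunctional i j x = C / α.coord i - C / α.coord j}

variable (α C C') in
theorem isClosed_walls : IsClosed (α.walls C C') := by
  refine ((isClosed_iUnion_of_finite fun j => ?_).union
    (isClosed_iUnion_of_finite fun j => ?_)).union
    (isClosed_iUnion_of_finite fun i => isClosed_iUnion_of_finite fun j =>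
      isClosed_iUnion_of_finite fun _ => ?_) <;>
  exact isClosed_eq (ContinuousLinearMap.continuous _) continuous_const

variable (α C C') in
theorem leb_walls : lebOnePerp d (α.walls C C') = 0 := by
  refine measure_union_null (measure_union_null ?_ ?_) ?_
  · exact measure_iUnion_null fun j => addHaar_level_set _ (α.coordL_ne_zero j) _
  · exact measure_iUnion_null fun j => addHaar_level_set _ (α.coordL_ne_zero j) _
  · exact measure_iUnion_null fun i => measure_iUnion_null fun j => measure_iUnion_null fun h =>
      addHaar_level_set _ (α.tieFunctional_ne_zero h) _

theorem exists_mem_region (hC' : 1 - 1 / (d : ℝ) ≤ C') {x : onePerp d} (hx : ∀ j, -C' ≤ x.1 j)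
    (hw : x ∉ α.walls C C') : ∃ i, x ∈ α.region C C' i := by
  classical
  obtain ⟨i, h1, h2, h3⟩ := exists_mem_S (α := α) (C := C) hC' hx
  have hw1 : ∀ j, x.1 j ≠ -C' := fun j h => hw (.inl (.inl (mem_iUnion.2 ⟨j, h⟩)))
  have hw2 : ∀ j, x.1 j + α.coord j - 1 ≠ -C' := fun j h =>
    hw (.inl (.inr (mem_iUnion.2 ⟨j, by
      change x.1 j = _
      linarith⟩)))
  have hw3 : ∀ j, j ≠ i → (C - x.1 i) / α.coord i ≠ (C - x.1 j) / α.coord j := fun j hj h =>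
    hw (.inr (mem_iUnion.2 ⟨j, mem_iUnion.2 ⟨i, mem_iUnion.2 ⟨hj,
      (α.div_eq_div_iff_tie C i j x).1 h⟩⟩⟩))
  refine ⟨i, mem_iUnion.2 ⟨Finset.univ.filter fun j => -C' ≤ x.1 j + α.coord j - 1, ?_⟩⟩
  refine ⟨fun j => lt_of_le_of_ne (hx j) (hw1 j).symm, lt_of_le_of_ne h2 (hw2 i).symm,
    fun j hj => ?_, fun j hj => ?_, fun j hj => ?_⟩
  · exact lt_of_le_of_ne (Finset.mem_filter.1 hj).2 (hw2 j).symm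
  · exact not_le.1 fun h => hj (Finset.mem_filter.2 ⟨Finset.mem_univ _, h⟩)
  · exact lt_of_le_of_ne (h3 j (Finset.mem_filter.1 hj.1).2) (hw3 j hj.2)

theorem measurableSet_S (i : Fin d) : MeasurableSet (α.S C C' i) := by
  have hc : ∀ j : Fin d, Measurable fun x : onePerp d => x.1 j :=
    fun j => (onePerp.continuous_coord j).measurable
  have : α.S C C' i = (⋂ j, {x | -C' ≤ x.1 j}) ∩ ({x | -C' ≤ x.1 i + α.coord i - 1} ∩
      ⋂ j, ({x | -C' ≤ x.1 j + α.coord j - 1}ᶜ ∪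
        {x | (C - x.1 i) / α.coord i ≤ (C - x.1 j) / α.coord j})) := by
    ext x
    simp only [S, mem_inter_iff, mem_iInter, mem_ofPred_eq, mem_union, mem_compl_iff,
      ← imp_iff_not_or]
  rw [this]
  have hfeas : ∀ j, MeasurableSet {x : onePerp d | -C' ≤ x.1 j + α.coord j - 1} := fun j =>
    measurableSet_le measurable_const (((hc j).add_const _).sub_const _)
  refine (MeasurableSet.iInter fun j => measurableSet_le measurable_const (hc j)).inter
    ((hfeas i).inter (MeasurableSet.iInter fun j => (hfeas j).compl.union ?_))
  exact measurableSet_le (((hc i).const_sub _).div_const _) (((hc j).const_sub _).div_const _)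

variable (α C C') in
theorem measurable_That : Measurable (α.That C C') := by
  classical
  -- The branch depends on `x` only through the finite set of admissible indices, so the map is
  -- glued from finitely many measurable ones along measurable sets.
  let I : onePerp d → Finset (Fin d) := fun x => Finset.univ.filter fun i => x ∈ α.S C C' i
  have hI : ∀ F, MeasurableSet (I ⁻¹' {F}) := by
    intro F
    have : I ⁻¹' {F} = ⋂ i, if i ∈ F then α.S C C' i else (α.S C C' i)ᶜ := by
      ext x
      simp only [I, mem_preimage, mem_singleton_iff, Finset.ext_iff, Finset.mem_filter,
        Finset.mem_univ, true_and, mem_iInter]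
      refine forall_congr' fun i => ?_
      by_cases hi : i ∈ F <;> simp [hi]
    rw [this]
    refine MeasurableSet.iInter fun i => ?_
    split_ifs
    exacts [measurableSet_S i, (measurableSet_S i).compl]
  let g : Finset (Fin d) → onePerp d → onePerp d := fun F x =>
    if h : F.Nonempty then x + α.step (F.min' h) else x
  have hT : α.That C C' = fun x => g (I x) x := by
    funext x
    simp only [That, g, I]
  have hg : ∀ F, Measurable (g F) := by
    intro F
    by_cases h : F.Nonempty
    · simp only [g, h, dite_true]
      exact measurable_id.add_const _
    · simp only [g, h, dite_false]
      exact measurable_id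
  intro s hs
  have : α.That C C' ⁻¹' s = ⋃ F, (I ⁻¹' {F} ∩ g F ⁻¹' s) := by
    ext x
    simp [hT]
  rw [this]
  exact MeasurableSet.iUnion fun F => (hI F).inter (hg F hs)

end FrequencyVector

/-! The orbit closure. -/

namespace FrequencyVector

variable {d : ℕ} {α : FrequencyVector d} {C C' : ℝ}

theorem toTorus_That (hC' : 1 - 1 / (d : ℝ) ≤ C') {x : onePerp d} (hx : ∀ j, -C' ≤ x.1 j) :
    toTorus d (α.That C C' x) = toTorus d x + α.torusVector := by
  obtain ⟨i, -, h⟩ := That_eq_of_nonempty (exists_mem_S (α := α) (C := C) hC' hx)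
  rw [h, map_add, toTorus_step]

theorem isClosed_D : IsClosed (α.D C C') := isClosed_closure

namespace IsTijdemanParameters

theorem mem_Icc_of_mem_D (h0 : α.IsTijdemanParameters C C' 0)
    {x : onePerp d} (hx : x ∈ α.D C C') (i : Fin d) :
    x.1 i ∈ Icc (-C') C := by
  have hcl : IsClosed {x : onePerp d | x.1 i ∈ Icc (-C') C} :=
    isClosed_Icc.preimage (onePerp.continuous_coord i)
  refine closure_minimal ?_ hcl hx
  rintro _ ⟨n, rfl⟩
  exact h0.orbit_mem n i

theorem isCompact_D (h0 : α.IsTijdemanParameters C C' 0) : IsCompact (α.D C C') := by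
  refine Metric.isCompact_of_isClosed_isBounded isClosed_D
    (Metric.isBounded_closedBall (x := 0) (r := max |C| |C'|) |>.subset fun x hx => ?_)
  rw [mem_closedBall_zero_iff]
  change ‖x.1‖ ≤ _
  rw [pi_norm_le_iff_of_nonneg (le_max_of_le_left (abs_nonneg _))]
  intro i
  have hi := h0.mem_Icc_of_mem_D hx i
  rw [Real.norm_eq_abs, abs_le]
  have h1 := neg_abs_le C
  have h2 := le_abs_self C
  have h3 := le_abs_self C'
  have h4 := le_max_left |C| |C'|
  have h5 := le_max_right |C| |C'|
  constructor <;> linarith [hi.1, hi.2]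

theorem toTorus_orbit (h0 : α.IsTijdemanParameters C C' 0)
    (n : ℕ) : toTorus d ((α.That C C')^[n] 0) = n • α.torusVector := by
  induction n with
  | zero => simp
  | succ n ih =>
    rw [Function.iterate_succ_apply', toTorus_That h0.le_C' (fun j => (h0.orbit_mem n j).1), ih,
      succ_nsmul]

/-- The image of the compact set `D` is closed and contains the forward orbit of 0 on the torus,
which is dense by Kronecker. -/
theorem exists_mem_D (h0 : α.IsTijdemanParameters C C' 0)
    (y : UnitAddTorus (Fin (d - 1))) : ∃ x ∈ α.D C C', toTorus d x = y := by
  have hcl : IsClosed (toTorus d '' α.D C C') :=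
    (h0.isCompact_D.image continuous_toTorus).isClosed
  have : y ∈ toTorus d '' α.D C C' := by
    refine closure_minimal ?_ hcl (h0.totallyIrrational.denseRange_torusVector y)
    rintro _ ⟨n, rfl⟩
    exact ⟨_, subset_closure ⟨n, rfl⟩, h0.toTorus_orbit n⟩
  exact this

/-- The region is open, so a point of `D` in it is a limit of orbit points in it, whose successors
lie on the orbit. -/
theorem add_step_mem_D {x : onePerp d} (hx : x ∈ α.D C C') {i : Fin d}
    (hi : x ∈ α.region C C' i) : x + α.step i ∈ α.D C C' := by
  have hx' : x ∈ closure ((range fun n : ℕ => (α.That C C')^[n] 0) ∩ α.region C C' i) :=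
    IsOpen.closure_inter (α.isOpen_region C C' i) ⟨hx, hi⟩
  have hmaps : MapsTo (· + α.step i)
      ((range fun n : ℕ => (α.That C C')^[n] 0) ∩ α.region C C' i)
      (range fun n : ℕ => (α.That C C')^[n] 0) := by
    rintro _ ⟨⟨n, rfl⟩, hn⟩
    refine ⟨n + 1, ?_⟩
    simp only [Function.iterate_succ_apply']
    exact That_eq_of_mem_region hn
  exact hmaps.closure (continuous_add_const _) hx'

/-- Every point of the orbit closure except the origin has a predecessor there. -/
theorem exists_sub_step_mem_D (h0 : α.IsTijdemanParameters C C' 0)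
    {x : onePerp d} (hx : x ∈ α.D C C') (hx0 : x ≠ 0) :
    ∃ i, x - α.step i ∈ α.D C C' ∧ ∀ j, x - α.step i ∈ α.region C C' j → j = i := by
  -- Orbit points other than the start are grouped by the last step taken. There are finitely many
  -- groups, so the covering passes to the closure.
  let E : Fin d → Set (onePerp d) := fun i =>
    {y | y ∈ (range fun n : ℕ => (α.That C C')^[n] 0) ∧ α.That C C' y = y + α.step i}
  have hE : range (fun n : ℕ => (α.That C C')^[n] 0) ⊆
      {0} ∪ ⋃ i, (· - α.step i) ⁻¹' closure (E i) := by
    rintro _ ⟨n, rfl⟩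
    rcases n with _ | n
    · exact .inl rfl
    · right
      obtain ⟨i, -, hi⟩ := That_eq_of_nonempty
        (exists_mem_S (α := α) (C := C) h0.le_C' fun j => (h0.orbit_mem n j).1)
      refine mem_iUnion.2 ⟨i, subset_closure ?_⟩
      simp only [Function.iterate_succ_apply', hi, add_sub_cancel_right]
      exact ⟨⟨n, rfl⟩, hi⟩
  have hcl : IsClosed ({0} ∪ ⋃ i, (· - α.step i) ⁻¹' closure (E i)) :=
    isClosed_singleton.union (isClosed_iUnion_of_finite fun i =>
      isClosed_closure.preimage (continuous_sub_right _))
  rcases closure_minimal hE hcl hx with h | h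
  · exact absurd h hx0
  · obtain ⟨i, hi⟩ := mem_iUnion.1 h
    have hi' : x - α.step i ∈ closure (E i) := hi
    refine ⟨i, closure_mono (fun y hy => hy.1) hi', fun j hj => ?_⟩
    -- Near a point of region `j` there are orbit points that took step `i`, but every point of the
    -- region takes step `j`.
    obtain ⟨y, hyj, hyi⟩ := mem_closure_iff.1 hi' _ (α.isOpen_region C C' j) hj
    have := hyi.2
    rw [That_eq_of_mem_region hyj] at this
    exact α.step_injective (add_left_cancel this)

/-- The images of the pieces of the orbit closure overlap in null sets: `T̂` is almost surely
injective on the orbit closure. -/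
theorem leb_overlap (h0 : α.IsTijdemanParameters C C' 0) {i j : Fin d} (hij : i ≠ j) :
    lebOnePerp d ((α.step i +ᵥ (α.D C C' ∩ α.region C C' i)) ∩
      (α.step j +ᵥ (α.D C C' ∩ α.region C C' j))) = 0 := by
  set μ := lebOnePerp d
  let A : Fin d → Set (onePerp d) := fun i => α.D C C' ∩ α.region C C' i
  have hAm : ∀ i, MeasurableSet (A i) := fun i =>
    isClosed_D.measurableSet.inter (α.isOpen_region C C' i).measurableSet
  have hAd : Pairwise (Function.onFun Disjoint A) := fun i j hij =>
    (region_disjoint hij).mono inter_subset_right inter_subset_right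
  have hfin : μ (α.D C C') ≠ ⊤ := h0.isCompact_D.measure_lt_top.ne
  let N : Set (onePerp d) := {0} ∪ ⋃ i, (· - α.step i) ⁻¹' α.walls C C'
  -- Points are null only in positive dimension, which holds because α_i < 1.
  have hnt : Nontrivial (onePerp d) := by
    have h1 := α.coordL_ne_zero ⟨0, α.card_pos⟩
    obtain ⟨x, hx⟩ : ∃ x, onePerp.coordL ⟨0, α.card_pos⟩ x ≠ 0 := by
      by_contra! h
      exact h1 (ContinuousLinearMap.ext h)
    exact ⟨x, 0, fun h => hx (by rw [h, map_zero])⟩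
  have hN : μ N = 0 := by
    refine measure_union_null (measure_singleton _) (measure_iUnion_null fun i => ?_)
    simp only [sub_eq_add_neg]
    rw [measure_preimage_add_right]
    exact α.leb_walls C C'
  -- The predecessor of a point of `D` outside `N` avoids the walls, hence lies in the region of the
  -- step that was taken.
  have hcover : α.D C C' ⊆ (⋃ i, (α.step i +ᵥ A i)) ∪ N := by
    intro x hx
    by_cases hxN : x ∈ N
    · exact .inr hxN
    left
    obtain ⟨i, hi, hi'⟩ := h0.exists_sub_step_mem_D hx fun h => hxN (.inl h)
    obtain ⟨j, hj⟩ := exists_mem_region (α := α) (C := C) h0.le_C'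
      (fun k => (h0.mem_Icc_of_mem_D hi k).1) fun h => hxN (.inr (mem_iUnion.2 ⟨i, h⟩))
    obtain rfl := hi' j hj
    refine mem_iUnion.2 ⟨j, mem_vadd_set_iff_neg_vadd_mem.2 ?_⟩
    rw [vadd_eq_add, neg_add_eq_sub]
    exact ⟨hi, hj⟩
  have hsum : ∑ i, μ (A i) ≤ μ (α.D C C') := by
    rw [← tsum_fintype (L := .unconditional _), ← measure_iUnion hAd hAm]
    exact measure_mono (iUnion_subset fun i => inter_subset_left)
  have hAe : ∀ i, μ (α.step i +ᵥ A i) = μ (A i) := fun i => measure_vadd _ _ _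
  have hvm : ∀ i, MeasurableSet (α.step i +ᵥ A i) := fun i => (hAm i).const_vadd _
  classical
  have hunion : ⋃ k, (α.step k +ᵥ A k) ⊆
      ((α.step i +ᵥ A i) ∪ (α.step j +ᵥ A j)) ∪
        ⋃ k ∈ (Finset.univ.erase i).erase j, (α.step k +ᵥ A k) := by
    refine iUnion_subset fun k x hx => ?_
    by_cases hki : k = i
    · exact .inl (.inl (hki ▸ hx))
    by_cases hkj : k = j
    · exact .inl (.inr (hkj ▸ hx))
    exact .inr (mem_biUnion (by simp [hki, hkj]) hx)
  have hle : μ (α.D C C') ≤ μ ((α.step i +ᵥ A i) ∪ (α.step j +ᵥ A j)) +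
      ∑ k ∈ (Finset.univ.erase i).erase j, μ (A k) := by
    calc μ (α.D C C') ≤ μ ((⋃ i, (α.step i +ᵥ A i)) ∪ N) := measure_mono hcover
      _ ≤ μ (⋃ i, (α.step i +ᵥ A i)) + μ N := measure_union_le _ _
      _ = μ (⋃ i, (α.step i +ᵥ A i)) := by rw [hN, add_zero]
      _ ≤ _ := measure_mono hunion
      _ ≤ _ := measure_union_le _ _
      _ ≤ _ := by
        gcongr
        refine (measure_biUnion_finset_le _ _).trans_eq ?_
        simp only [hAe]
  have hsplit : ∑ k, μ (A k) =
      μ (A i) + μ (A j) + ∑ k ∈ (Finset.univ.erase i).erase j, μ (A k) := by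
    rw [← Finset.add_sum_erase _ _ (Finset.mem_univ i),
      ← Finset.add_sum_erase (Finset.univ.erase i) _ (Finset.mem_erase.2 ⟨hij.symm,
        Finset.mem_univ j⟩), add_assoc]
  have hue := measure_union_add_inter (μ := μ) (α.step i +ᵥ A i) (hvm j)
  rw [hAe, hAe] at hue
  set S' := ∑ k ∈ (Finset.univ.erase i).erase j, μ (A k)
  set u := μ ((α.step i +ᵥ A i) ∪ (α.step j +ᵥ A j))
  set v := μ ((α.step i +ᵥ A i) ∩ (α.step j +ᵥ A j))
  -- The disjoint pieces have total mass at most that of `D`, and their translates cover `D`, so no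
  -- mass `v` is left for an overlap. Finiteness of the measure of `D` permits the cancellation.
  have hfinal : (u + S') + v ≤ u + S' := by
    calc (u + S') + v = (u + v) + S' := by ring
      _ = ∑ k, μ (A k) := by rw [hue, hsplit]
      _ ≤ μ (α.D C C') := hsum
      _ ≤ u + S' := hle
  have hne : u + S' ≠ ⊤ := by
    intro htop
    refine hfin (top_le_iff.1 ?_)
    calc ⊤ = (u + S') := htop.symm
      _ ≤ (u + S') + v := le_self_add
      _ = (u + v) + S' := by ring
      _ = ∑ k, μ (A k) := by rw [hue, hsplit]
      _ ≤ μ (α.D C C') := hsum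
  have := ENNReal.le_of_add_le_add_left hne (hfinal.trans_eq (add_zero _).symm)
  exact le_antisymm this bot_le

end IsTijdemanParameters

end FrequencyVector

/-! Generic points and the structure of the orbit closure. -/

namespace FrequencyVector

variable {d : ℕ} (α : FrequencyVector d) (C C' : ℝ)

/-- The countable group `(ℤα + ℤ^d) ∩ 1^⊥`. -/
def translationGroup : AddSubgroup (onePerp d) where
  carrier := {x | ∃ (m : ℤ) (n : Fin d → ℤ), ∀ i, x.1 i = m * α.coord i + n i}
  add_mem' := by
    rintro x y ⟨m, n, h⟩ ⟨m', n', h'⟩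
    refine ⟨m + m', n + n', fun i => ?_⟩
    change x.1 i + y.1 i = _
    rw [h, h']
    push_cast [Pi.add_apply]
    ring
  zero_mem' := ⟨0, 0, fun i => by simp⟩
  neg_mem' := by
    rintro x ⟨m, n, h⟩
    refine ⟨-m, -n, fun i => ?_⟩
    change -x.1 i = _
    rw [h]
    push_cast [Pi.neg_apply]
    ring

theorem countable_translationGroup : (α.translationGroup : Set (onePerp d)).Countable := by
  have h : (range fun q : ℤ × (Fin d → ℤ) => fun i => (q.1 : ℝ) * α.coord i + q.2 i).Countable :=
    countable_range _
  refine (h.preimage (f := (Subtype.val : onePerp d → _)) Subtype.val_injective).mono ?_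
  rintro x ⟨m, n, hx⟩
  exact ⟨(m, n), (funext hx).symm⟩

theorem lattice_le_translationGroup : onePerpLattice d ≤ α.translationGroup := by
  intro x hx
  choose n hn using hx
  exact ⟨0, n, fun i => by simp [hn]⟩

theorem step_mem_translationGroup (i : Fin d) : α.step i ∈ α.translationGroup := by
  refine ⟨1, fun j => -(Pi.single i 1 : Fin d → ℤ) j, fun j => ?_⟩
  rw [step_apply]
  by_cases h : j = i
  · subst h; simp; ring
  · simp [h]

/-- The walls, together with the overlaps of the images of the cells under `T̂`. -/
def exceptionalSet : Set (onePerp d) :=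
  α.walls C C' ∪ ⋃ i, ⋃ j, ⋃ _ : i ≠ j, ((α.step i +ᵥ (α.D C C' ∩ α.region C C' i)) ∩
      (α.step j +ᵥ (α.D C C' ∩ α.region C C' j)))

theorem measurableSet_exceptionalSet : MeasurableSet (α.exceptionalSet C C') := by
  have h : ∀ i, MeasurableSet (α.step i +ᵥ (α.D C C' ∩ α.region C C' i)) := fun i =>
    (isClosed_D.measurableSet.inter (α.isOpen_region C C' i).measurableSet).const_vadd _
  exact (α.isClosed_walls C C').measurableSet.union (MeasurableSet.iUnion fun i =>
    MeasurableSet.iUnion fun j => MeasurableSet.iUnion fun _ => (h i).inter (h j))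

/-- The points whose class modulo `(ℤα + ℤ^d) ∩ 1^⊥` avoids the exceptional set. -/
def generic : Set (onePerp d) :=
  {x | ∀ γ ∈ α.translationGroup, γ + x ∉ α.exceptionalSet C C'}

theorem measurableSet_generic : MeasurableSet (α.generic C C') := by
  have : α.generic C C' = ⋂ γ ∈ α.translationGroup, (γ + ·) ⁻¹' (α.exceptionalSet C C')ᶜ := by
    ext x
    simp [generic]
  rw [this]
  exact MeasurableSet.biInter α.countable_translationGroup fun γ _ =>
    measurable_const_add γ (α.measurableSet_exceptionalSet C C').compl

variable {α C C'}

/-- The group contains Λ and all steps, so genericity persists along orbits and depends only on the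
class modulo Λ. -/
theorem add_mem_generic {x γ : onePerp d} (hx : x ∈ α.generic C C')
    (hγ : γ ∈ α.translationGroup) : x + γ ∈ α.generic C C' := by
  intro γ' hγ'
  rw [add_comm x, ← add_assoc]
  exact hx _ (add_mem hγ' hγ)

theorem notMem_exceptionalSet {x : onePerp d} (hx : x ∈ α.generic C C') :
    x ∉ α.exceptionalSet C C' := by
  simpa using hx 0 (zero_mem _)

theorem sub_mem_translationGroup_of_toTorus_eq {x y : onePerp d} {k : ℕ}
    (h : toTorus d x = toTorus d y + k • α.torusVector) : y - x ∈ α.translationGroup := by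
  have h1 : toTorus d x = toTorus d (y + k • α.step α.last) := by
    rw [h, map_add, map_nsmul]
    rfl
  have h2 := α.lattice_le_translationGroup (toTorus_eq_iff.1 h1)
  have h3 := add_mem h2 (nsmul_mem (α.step_mem_translationGroup α.last) k)
  have h4 : x - (y + k • α.step α.last) + k • α.step α.last = -(y - x) := by abel
  rw [h4] at h3
  exact neg_mem_iff.1 h3

/-! ### A neighbourhood of the origin and its forward images. -/

variable (C C') in
/-- A neighbourhood of the origin whose points are the only representatives of their class
modulo the lattice in the box `[-C', C]^d`. -/
def originCell (_α : FrequencyVector d) : Set (onePerp d) :=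
  {x | (∀ i, C - 1 < x.1 i) ∧ ∀ i, x.1 i < 1 - C'}

theorem isOpenPolyhedron_originCell : IsOpenPolyhedron (α.originCell C C') := by
  have h1 : ∀ i : Fin d, IsOpenPolyhedron {x : onePerp d | C - 1 < x.1 i} := by
    intro i
    convert IsOpenPolyhedron.halfSpace (-onePerp.coordL i) (1 - C) using 1
    ext x
    simp only [mem_ofPred_eq, neg_apply, onePerp.coordL_apply]
    constructor <;> intro h <;> linarith
  have h2 : ∀ i : Fin d, IsOpenPolyhedron {x : onePerp d | x.1 i < 1 - C'} := fun i =>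
    .halfSpace (onePerp.coordL i) _
  convert (IsOpenPolyhedron.iInter h1).inter (IsOpenPolyhedron.iInter h2) using 1
  ext x
  simp [originCell]

/-- The coordinates of `w - u` are integers strictly between -1 and 1. -/
theorem eq_of_mem_originCell {u w : onePerp d} (hu : u ∈ α.originCell C C')
    (hw : ∀ i, w.1 i ∈ Icc (-C') C) (h : toTorus d w = toTorus d u) : w = u := by
  rw [toTorus_eq_iff] at h
  ext i
  obtain ⟨n, hn⟩ := h i
  have hn' : w.1 i - u.1 i = n := hn
  have h1 : n < 1 := by
    have : (n : ℝ) < 1 := by linarith [(hw i).2, hu.1 i]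
    exact_mod_cast this
  have h2 : -1 < n := by
    have : (-1 : ℝ) < n := by linarith [(hw i).1, hu.2 i]
    exact_mod_cast this
  have : n = 0 := by omega
  rw [this] at hn'
  simpa [sub_eq_zero] using hn'

variable (α C C') in
/-- The polyhedra obtained from the cell around the origin by `k` applications of `T̂`. -/
def forwardCells : ℕ → Set (Set (onePerp d))
  | 0 => {α.originCell C C'}
  | k + 1 => ⋃ κ : Finset (Fin d) × Fin d,
      (fun O => α.step κ.2 +ᵥ (O ∩ α.cell C C' κ)) '' forwardCells k

theorem finite_forwardCells (k : ℕ) : (α.forwardCells C C' k).Finite := by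
  induction k with
  | zero => exact finite_singleton _
  | succ k ih => exact finite_iUnion fun κ => ih.image _

theorem isOpenPolyhedron_of_mem_forwardCells {k : ℕ} {O : Set (onePerp d)}
    (hO : O ∈ α.forwardCells C C' k) : IsOpenPolyhedron O := by
  induction k generalizing O with
  | zero =>
    obtain rfl : O = _ := hO
    exact isOpenPolyhedron_originCell
  | succ k ih =>
    obtain ⟨κ, O', hO', rfl⟩ := mem_iUnion.1 hO
    exact ((ih hO').inter (α.isOpenPolyhedron_cell C C' κ)).vadd _

theorem cell_subset_region (κ : Finset (Fin d) × Fin d) : α.cell C C' κ ⊆ α.region C C' κ.2 :=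
  fun _ hx => mem_iUnion.2 ⟨κ.1, hx⟩

namespace IsTijdemanParameters

theorem leb_compl_generic (h0 : α.IsTijdemanParameters C C' 0) :
    lebOnePerp d (α.generic C C')ᶜ = 0 := by
  have hE : lebOnePerp d (α.exceptionalSet C C') = 0 :=
    measure_union_null (α.leb_walls C C') (measure_iUnion_null fun i => measure_iUnion_null fun j =>
      measure_iUnion_null fun hij => h0.leb_overlap hij)
  have : (α.generic C C')ᶜ = ⋃ γ ∈ α.translationGroup, (γ + ·) ⁻¹' (α.exceptionalSet C C') := by
    ext x
    simp [generic]
  rw [this]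
  refine (measure_biUnion_null_iff α.countable_translationGroup).2 fun γ _ => ?_
  rw [measure_preimage_add, hE]

theorem dense_generic (h0 : α.IsTijdemanParameters C C' 0) : Dense (α.generic C C') :=
  Measure.dense_of_ae (μ := lebOnePerp d) (p := (· ∈ α.generic C C')) h0.leb_compl_generic

theorem exists_mem_region_of_generic (h0 : α.IsTijdemanParameters C C' 0) {x : onePerp d}
    (hx : x ∈ α.D C C' ∩ α.generic C C') : ∃ i, x ∈ α.region C C' i :=
  exists_mem_region h0.le_C' (fun j => (h0.mem_Icc_of_mem_D hx.1 j).1)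
    fun h => notMem_exceptionalSet hx.2 (.inl h)

theorem mapsTo_That (h0 : α.IsTijdemanParameters C C' 0) :
    MapsTo (α.That C C') (α.D C C' ∩ α.generic C C') (α.D C C' ∩ α.generic C C') := by
  intro x hx
  obtain ⟨i, hi⟩ := h0.exists_mem_region_of_generic hx
  rw [That_eq_of_mem_region hi]
  exact ⟨add_step_mem_D hx.1 hi, add_mem_generic hx.2 (α.step_mem_translationGroup i)⟩

/-- Two preimages with different indices would put their common image in an overlap, which
genericity excludes. -/
theorem injOn_That (h0 : α.IsTijdemanParameters C C' 0) :
    InjOn (α.That C C') (α.D C C' ∩ α.generic C C') := by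
  intro x hx y hy hxy
  obtain ⟨i, hi⟩ := h0.exists_mem_region_of_generic hx
  obtain ⟨j, hj⟩ := h0.exists_mem_region_of_generic hy
  have hTx := (h0.mapsTo_That hx).2
  rw [That_eq_of_mem_region hi, That_eq_of_mem_region hj] at hxy
  by_cases hij : i = j
  · subst hij
    exact add_right_cancel hxy
  · rw [That_eq_of_mem_region hi] at hTx
    refine absurd ?_ (notMem_exceptionalSet hTx)
    refine .inr (mem_iUnion.2 ⟨i, mem_iUnion.2 ⟨j, mem_iUnion.2 ⟨hij, ?_, ?_⟩⟩⟩)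
    · exact ⟨x, ⟨hx.1, hi⟩, add_comm _ _⟩
    · rw [hxy]
      exact ⟨y, ⟨hy.1, hj⟩, add_comm _ _⟩

theorem toTorus_iterate_That (h0 : α.IsTijdemanParameters C C' 0) {x : onePerp d}
    (hx : x ∈ α.D C C' ∩ α.generic C C') (k : ℕ) :
    toTorus d ((α.That C C')^[k] x) = toTorus d x + k • α.torusVector := by
  induction k with
  | zero => simp
  | succ k ih =>
    have := h0.mapsTo_That.iterate k hx
    rw [Function.iterate_succ_apply', toTorus_That h0.le_C'
      (fun j => (h0.mem_Icc_of_mem_D this.1 j).1), ih, succ_nsmul, add_assoc]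

/-- Generic points of the orbit closure are determined by their class modulo the lattice. -/
theorem injOn_toTorus (h0 : α.IsTijdemanParameters C C' 0) (hC : C < 1) (hC' : C' < 1) :
    InjOn (toTorus d) (α.D C C' ∩ α.generic C C') := by
  intro x hx y hy hxy
  obtain ⟨k, u, hu, hk⟩ := h0.totallyIrrational.exists_nsmul_mem x
    (isOpenPolyhedron_originCell (α := α) (C := C) (C' := C')).isOpen
    ⟨0, fun i => by simpa using hC, fun i => by simpa using hC'⟩
  -- Every generic point of `D` in the class of `x` must be at `u` at time `k`, since `u` is the
  -- only representative of its class in the box. Injectivity of the iterate then identifies the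
  -- starting points.
  have hall : ∀ z ∈ α.D C C' ∩ α.generic C C', toTorus d z = toTorus d x →
      (α.That C C')^[k] z = u := by
    intro z hz hzx
    refine eq_of_mem_originCell hu (h0.mem_Icc_of_mem_D (h0.mapsTo_That.iterate k hz).1) ?_
    rw [h0.toTorus_iterate_That hz, hk, hzx]
  exact h0.injOn_That.iterate h0.mapsTo_That k hx hy
    ((hall x hx rfl).trans (hall y hy hxy.symm).symm)

/-- `D` meets every class inside the box, and a class meeting the cell has only one representative
in the box. -/
theorem originCell_subset_D (h0 : α.IsTijdemanParameters C C' 0) :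
    α.originCell C C' ⊆ α.D C C' := by
  intro u hu
  obtain ⟨w, hw, h⟩ := h0.exists_mem_D (toTorus d u)
  rwa [← eq_of_mem_originCell hu (h0.mem_Icc_of_mem_D hw) h]

theorem subset_D_of_mem_forwardCells (h0 : α.IsTijdemanParameters C C' 0) {k : ℕ}
    {O : Set (onePerp d)} (hO : O ∈ α.forwardCells C C' k) : O ⊆ α.D C C' := by
  induction k generalizing O with
  | zero =>
    obtain rfl : O = _ := hO
    exact h0.originCell_subset_D
  | succ k ih =>
    obtain ⟨κ, O', hO', rfl⟩ := mem_iUnion.1 hO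
    rintro _ ⟨x, hx, rfl⟩
    change α.step κ.2 + x ∈ _
    rw [add_comm]
    exact add_step_mem_D (ih hO' hx.1) (cell_subset_region κ hx.2)

theorem iterate_That_mem_forwardCells (h0 : α.IsTijdemanParameters C C' 0) {u : onePerp d}
    (hu : u ∈ α.originCell C C' ∩ α.generic C C') (k : ℕ) :
    (α.That C C')^[k] u ∈ ⋃₀ α.forwardCells C C' k := by
  have huD : u ∈ α.D C C' ∩ α.generic C C' := ⟨h0.originCell_subset_D hu.1, hu.2⟩
  induction k with
  | zero => exact ⟨_, rfl, hu.1⟩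
  | succ k ih =>
    obtain ⟨O, hO, hmem⟩ := ih
    obtain ⟨i, hi⟩ := h0.exists_mem_region_of_generic (h0.mapsTo_That.iterate k huD)
    obtain ⟨F, hF⟩ := mem_iUnion.1 hi
    rw [Function.iterate_succ_apply', That_eq_of_mem_region hi]
    exact ⟨_, mem_iUnion.2 ⟨(F, i), O, hO, rfl⟩, _, ⟨hmem, hF⟩, add_comm _ _⟩

/-- Up to nongeneric points, the orbit closure is a finite union of open polyhedra. -/
theorem exists_polyhedra (h0 : α.IsTijdemanParameters C C' 0) (hC : C < 1) (hC' : C' < 1) :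
    ∃ 𝒪 : Set (Set (onePerp d)), 𝒪.Finite ∧ (∀ O ∈ 𝒪, IsOpenPolyhedron O ∧ O ⊆ α.D C C') ∧
      α.D C C' ∩ α.generic C C' ⊆ ⋃₀ 𝒪 := by
  let U := α.originCell C C'
  have hU : IsOpen U := isOpenPolyhedron_originCell.isOpen
  have hU0 : (0 : onePerp d) ∈ U := ⟨fun i => by simpa using hC, fun i => by simpa using hC'⟩
  -- The classes reached from the origin cell in `k` steps.
  let W : ℕ → Set (UnitAddTorus (Fin (d - 1))) := fun k =>
    (fun y => y - k • α.torusVector) ⁻¹' (toTorus d '' U)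
  have hW : ∀ k, IsOpen (W k) := fun k =>
    (isOpenMap_toTorus _ hU).preimage (continuous_id.sub continuous_const)
  have hcov : (univ : Set (UnitAddTorus (Fin (d - 1)))) ⊆ ⋃ k, W k := by
    intro y _
    obtain ⟨x, rfl⟩ := toTorus_surjective y
    -- Starting from `-x` and aiming at `-U` converts density of forward orbits into reaching the
    -- class of `x` from `U`.
    obtain ⟨k, u, hu, hk⟩ := h0.totallyIrrational.exists_nsmul_mem (-x) hU.neg
      ⟨0, by simpa using hU0⟩
    refine mem_iUnion.2 ⟨k, -u, hu, ?_⟩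
    change toTorus d (-u) = toTorus d x - k • α.torusVector
    rw [map_neg, hk, map_neg]
    abel
  obtain ⟨t, ht⟩ := isCompact_univ.elim_finite_subcover W hW hcov
  refine ⟨⋃ k ∈ t, α.forwardCells C C' k, t.finite_toSet.biUnion fun k _ => finite_forwardCells k,
    ?_, ?_⟩
  · intro O hO
    obtain ⟨k, -, hO⟩ := mem_iUnion₂.1 hO
    exact ⟨isOpenPolyhedron_of_mem_forwardCells hO, h0.subset_D_of_mem_forwardCells hO⟩
  · intro x hx
    obtain ⟨k, hk, u, hu, hux⟩ := mem_iUnion₂.1 (ht (mem_univ (toTorus d x)))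
    have hux' : toTorus d x = toTorus d u + k • α.torusVector :=
      (eq_sub_iff_add_eq.1 hux).symm
    have hug : u ∈ α.generic C C' := by
      have := add_mem_generic hx.2 (sub_mem_translationGroup_of_toTorus_eq hux')
      rwa [add_sub_cancel] at this
    have huD : u ∈ α.D C C' ∩ α.generic C C' := ⟨h0.originCell_subset_D hu, hug⟩
    have hxu : x = (α.That C C')^[k] u := h0.injOn_toTorus hC hC' hx
      (h0.mapsTo_That.iterate k huD) (by rw [h0.toTorus_iterate_That huD, hux'])
    obtain ⟨O, hO, hmem⟩ := h0.iterate_That_mem_forwardCells ⟨hu, hug⟩ k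
    exact ⟨O, mem_iUnion₂.2 ⟨k, hk, hO⟩, hxu ▸ hmem⟩

end IsTijdemanParameters

end FrequencyVector

/-! The tile `P` and its pieces. -/

namespace FrequencyVector

variable {d : ℕ} {α : FrequencyVector d} {C C' : ℝ}

theorem P_subset_D : α.P C C' ⊆ α.D C C' :=
  closure_minimal interior_subset isClosed_D

theorem closure_interior_P : closure (interior (α.P C C')) = α.P C C' :=
  closure_interior_idem

theorem piece_subset_P (i : Fin d) : α.piece C C' i ⊆ α.P C C' :=
  closure_minimal (inter_subset_left.trans interior_subset) isClosed_closure

/-- Off the walls a limit of points of `S i` lies in some open region, which meets `S i` and so has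
index `i`; the limit is then interior. -/
theorem frontier_interior_S_subset (hC' : 1 - 1 / (d : ℝ) ≤ C') (i : Fin d) :
    frontier (interior (α.S C C' i)) ⊆ α.walls C C' := by
  intro x hx
  by_contra hw
  rw [isOpen_interior.frontier_eq] at hx
  have hcl : IsClosed {x : onePerp d | ∀ j, -C' ≤ x.1 j} := by
    simp only [ofPred_forall]
    exact isClosed_iInter fun j => isClosed_le continuous_const (onePerp.continuous_coord j)
  have hxS := closure_minimal (fun y (hy : y ∈ interior (α.S C C' i)) => (interior_subset hy).1)
    hcl hx.1
  obtain ⟨j, hj⟩ := exists_mem_region (C := C) hC' hxS hw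
  obtain ⟨y, hyj, hyi⟩ := mem_closure_iff.1 hx.1 _ (α.isOpen_region C C' j) hj
  obtain rfl := eq_of_mem_region_of_mem_S hyj (interior_subset hyi)
  exact hx.2 (region_subset_interior_S _ hj)

namespace IsTijdemanParameters

theorem isCompact_P (h0 : α.IsTijdemanParameters C C' 0) : IsCompact (α.P C C') :=
  h0.isCompact_D.of_isClosed_subset isClosed_closure P_subset_D

/-- Generic points are dense in the interior of `D` and covered by `𝒪`; conversely each `O` is an
open subset of `D`. -/
theorem P_eq_closure (h0 : α.IsTijdemanParameters C C' 0) {𝒪 : Set (Set (onePerp d))}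
    (h𝒪 : ∀ O ∈ 𝒪, IsOpenPolyhedron O ∧ O ⊆ α.D C C')
    (hcov : α.D C C' ∩ α.generic C C' ⊆ ⋃₀ 𝒪) : α.P C C' = closure (⋃₀ 𝒪) := by
  apply Subset.antisymm
  · refine closure_minimal ?_ isClosed_closure
    refine (h0.dense_generic.open_subset_closure_inter isOpen_interior).trans (closure_mono ?_)
    exact (inter_subset_inter_left _ interior_subset).trans hcov
  · refine closure_mono (sUnion_subset fun O hO => ?_)
    exact interior_maximal (h𝒪 O hO).2 (h𝒪 O hO).1.isOpen

theorem generic_subset_P (h0 : α.IsTijdemanParameters C C' 0) (hC : C < 1) (hC' : C' < 1) :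
    α.D C C' ∩ α.generic C C' ⊆ α.P C C' := by
  obtain ⟨𝒪, -, h𝒪, hcov⟩ := h0.exists_polyhedra hC hC'
  rw [h0.P_eq_closure h𝒪 hcov]
  exact hcov.trans subset_closure

/-- The frontier is covered by the frontiers of finitely many convex sets, which are null. -/
theorem leb_frontier_interior_P (h0 : α.IsTijdemanParameters C C' 0) (hC : C < 1) (hC' : C' < 1) :
    lebOnePerp d (frontier (interior (α.P C C'))) = 0 := by
  obtain ⟨𝒪, hfin, h𝒪, hcov⟩ := h0.exists_polyhedra hC hC'
  rw [isOpen_interior.frontier_eq, closure_interior_P]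
  refine measure_mono_null (t := ⋃ O ∈ 𝒪, frontier O) ?_ ?_
  · rintro x ⟨hx, hxi⟩
    have hx' := hx
    rw [h0.P_eq_closure h𝒪 hcov, sUnion_eq_biUnion, hfin.closure_biUnion] at hx'
    obtain ⟨O, hO, hxO⟩ := mem_iUnion₂.1 hx'
    refine mem_iUnion₂.2 ⟨O, hO, ?_⟩
    rw [(h𝒪 O hO).1.isOpen.frontier_eq]
    refine ⟨hxO, fun h => hxi (interior_maximal ?_ (h𝒪 O hO).1.isOpen h)⟩
    rw [h0.P_eq_closure h𝒪 hcov]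
    exact (subset_sUnion_of_mem hO).trans subset_closure
  · exact (measure_biUnion_null_iff hfin.countable).2 fun O hO =>
      (h𝒪 O hO).1.convex.addHaar_frontier _

theorem interior_P_nonempty (h0 : α.IsTijdemanParameters C C' 0) (hC : C < 1) (hC' : C' < 1) :
    (interior (α.P C C')).Nonempty := by
  have h1 : (interior (α.D C C')).Nonempty :=
    ⟨0, interior_maximal h0.originCell_subset_D isOpenPolyhedron_originCell.isOpen
      ⟨fun i => by simpa using hC, fun i => by simpa using hC'⟩⟩
  exact h1.mono (interior_maximal subset_closure isOpen_interior)

/-- All generic classes are represented in `P`; they are dense and the image of `P` is compact, so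
all classes are. A generic point in an overlap would give two generic points of `D` in one class. -/
theorem isMeasurableFundamentalDomain_P (h0 : α.IsTijdemanParameters C C' 0) (hC : C < 1)
    (hC' : C' < 1) :
    IsMeasurableFundamentalDomain (lebOnePerp d) (onePerpLattice d) (α.P C C') where
  measurableSet := isClosed_closure.measurableSet
  add_lattice := by
    refine eq_univ_of_forall fun x => ?_
    have hcl : IsClosed (toTorus d '' α.P C C') := (h0.isCompact_P.image continuous_toTorus).isClosed
    have hdense : Dense (toTorus d '' α.generic C C') :=
      toTorus_surjective.denseRange.dense_image continuous_toTorus h0.dense_generic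
    have hsub : toTorus d '' α.generic C C' ⊆ toTorus d '' α.P C C' := by
      rintro _ ⟨y, hy, rfl⟩
      obtain ⟨z, hz, hzy⟩ := h0.exists_mem_D (toTorus d y)
      refine ⟨z, h0.generic_subset_P hC hC' ⟨hz, ?_⟩, hzy⟩
      have := add_mem_generic hy (α.lattice_le_translationGroup (toTorus_eq_iff.1 hzy))
      rwa [add_sub_cancel] at this
    obtain ⟨z, hz, hzx⟩ := closure_minimal hsub hcl (hdense (toTorus d x))
    have hxz : x - z ∈ onePerpLattice d := toTorus_eq_iff.1 hzx.symm
    exact Set.mem_add.2 ⟨z, hz, x - z, hxz, add_sub_cancel z x⟩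
  null_overlap n hn hn0 := by
    suffices h : α.P C C' ∩ (n +ᵥ α.P C C') ⊆ (α.generic C C')ᶜ from
      measure_mono_null h h0.leb_compl_generic
    rintro x ⟨hx1, y, hy, rfl⟩ hxG
    refine hn0 ?_
    have hxG' : n + y ∈ α.generic C C' := hxG
    have hyG : y ∈ α.generic C C' := by
      have := add_mem_generic hxG' (neg_mem (α.lattice_le_translationGroup hn))
      rwa [add_comm n, add_neg_cancel_right] at this
    have h := h0.injOn_toTorus hC hC' ⟨P_subset_D hx1, hxG'⟩ ⟨P_subset_D hy, hyG⟩
      (toTorus_eq_iff.2 (by simpa using hn))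
    simpa using h

/-- A nonempty open intersection would contain a generic point, where only one index is admissible.
-/
theorem disjoint_interiors (h0 : α.IsTijdemanParameters C C' 0) {i j : Fin d} (hij : i ≠ j) :
    Disjoint (interior (α.P C C') ∩ interior (α.S C C' i))
      (interior (α.P C C') ∩ interior (α.S C C' j)) := by
  rw [Set.disjoint_iff_inter_eq_empty]
  by_contra hne
  obtain ⟨x, hxG, hx⟩ := h0.dense_generic.exists_mem_open
    ((isOpen_interior.inter isOpen_interior).inter (isOpen_interior.inter isOpen_interior))
    (Set.nonempty_iff_ne_empty.2 hne)
  obtain ⟨k, hk⟩ := h0.exists_mem_region_of_generic ⟨P_subset_D (interior_subset hx.1.1), hxG⟩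
  exact hij ((eq_of_mem_region_of_mem_S hk (interior_subset hx.1.2)).trans
    (eq_of_mem_region_of_mem_S hk (interior_subset hx.2.2)).symm)

theorem leb_frontier_inter (h0 : α.IsTijdemanParameters C C' 0) (hC : C < 1) (hC' : C' < 1)
    (i : Fin d) :
    lebOnePerp d (frontier (interior (α.P C C') ∩ interior (α.S C C' i))) = 0 := by
  refine measure_mono_null (frontier_inter_subset _ _) (measure_union_null ?_ ?_)
  · exact measure_mono_null inter_subset_left (h0.leb_frontier_interior_P hC hC')
  · exact measure_mono_null (inter_subset_right.trans (frontier_interior_S_subset h0.le_C' i))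
      (α.leb_walls C C')

theorem isNaturalPartition_piece (h0 : α.IsTijdemanParameters C C' 0) (hC : C < 1) (hC' : C' < 1) :
    IsNaturalPartition (lebOnePerp d) (onePerpLattice d) (α.step α.last)
      (α.P C C') (α.piece C C') where
  fundamentalDomain := h0.isMeasurableFundamentalDomain_P hC hC'
  minimal := h0.totallyIrrational.isMinimalTranslation
  iUnion_eq := by
    refine Subset.antisymm (iUnion_subset piece_subset_P) ?_
    have hcl : IsClosed (⋃ i, α.piece C C' i) := isClosed_iUnion_of_finite fun _ => isClosed_closure
    rw [← closure_interior_P]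
    refine closure_minimal ?_ hcl
    refine (h0.dense_generic.open_subset_closure_inter isOpen_interior).trans
      (closure_minimal ?_ hcl)
    rintro x ⟨hx, hxG⟩
    obtain ⟨i, hi⟩ := h0.exists_mem_region_of_generic ⟨P_subset_D (interior_subset hx), hxG⟩
    exact mem_iUnion.2 ⟨i, subset_closure ⟨hx, region_subset_interior_S i hi⟩⟩
  -- The open sets defining the pieces are disjoint, so the closure of one misses the other, and the
  -- pieces meet only on a frontier.
  null_inter i j hij := by
    refine measure_mono_null ?_ (h0.leb_frontier_inter hC hC' i)
    rintro x ⟨hxi, hxj⟩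
    rw [(isOpen_interior.inter isOpen_interior).frontier_eq]
    exact ⟨hxi, fun hx => Set.disjoint_left.1 ((h0.disjoint_interiors hij).closure_right
      (isOpen_interior.inter isOpen_interior)) hx hxj⟩
  closure_interior i := by
    have : IsOpen (interior (α.P C C') ∩ interior (α.S C C' i)) :=
      isOpen_interior.inter isOpen_interior
    refine Subset.antisymm (closure_minimal interior_subset isClosed_closure) ?_
    exact closure_mono (interior_maximal subset_closure this)
  null_frontier i := measure_mono_null frontier_closure_subset (h0.leb_frontier_inter hC hC' i)
  exists_translation := by
    refine ⟨α.step, fun i => ⟨α.step_sub_step_mem i α.last, ?_⟩⟩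
    set U := interior (α.P C C') ∩ interior (α.S C C' i) with hU
    have hUo : IsOpen U := isOpen_interior.inter isOpen_interior
    have hUD : α.step i +ᵥ U ⊆ α.D C C' := by
      -- At generic points of `U` the map is translation by `step i` and stays in `D`. Density and
      -- closedness of `D` extend this to `U`, openness puts the image in the interior of `D`, and
      -- taking closures lands in `P`.
      have hmaps : MapsTo (α.step i + ·) (U ∩ α.generic C C') (α.D C C') := by
        rintro x ⟨hx, hxG⟩
        have hxD := P_subset_D (interior_subset hx.1)
        obtain ⟨k, hk⟩ := h0.exists_mem_region_of_generic ⟨hxD, hxG⟩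
        obtain rfl := eq_of_mem_region_of_mem_S hk (interior_subset hx.2)
        change α.step i + x ∈ _
        rw [add_comm]
        exact add_step_mem_D hxD hk
      rintro _ ⟨x, hx, rfl⟩
      have := hmaps.closure (continuous_const_add _)
        (h0.dense_generic.open_subset_closure_inter hUo hx)
      rwa [isClosed_D.closure_eq] at this
    have hUP : α.step i +ᵥ U ⊆ interior (α.D C C') := interior_maximal hUD (hUo.vadd _)
    rintro _ ⟨x, hx, rfl⟩
    have hmaps : MapsTo (α.step i + ·) U (interior (α.D C C')) := fun y hy => hUP ⟨y, hy, rfl⟩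
    exact hmaps.closure (continuous_const_add _) hx

/-- Every index is used on a nonempty set of generic points. -/
theorem exists_generic_mem_region (h0 : α.IsTijdemanParameters C C' 0) (hC : C < 1) (hC' : C' < 1)
    (i : Fin d) : ∃ x ∈ α.D C C' ∩ α.generic C C', x ∈ α.region C C' i := by
  by_contra! hno
  obtain ⟨x, hxG, hx⟩ := h0.dense_generic.exists_mem_open isOpen_interior
    (h0.interior_P_nonempty hC hC')
  have hxD : x ∈ α.D C C' ∩ α.generic C C' := ⟨P_subset_D (interior_subset hx), hxG⟩
  -- If index `i` is never chosen, coordinate `i` gains α_i at every step and eventually exceeds C.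
  have hgrow : ∀ n : ℕ, ((α.That C C')^[n] x).1 i = x.1 i + n * α.coord i := by
    intro n
    induction n with
    | zero => simp
    | succ n ih =>
      have hn := h0.mapsTo_That.iterate n hxD
      obtain ⟨j, hj⟩ := h0.exists_mem_region_of_generic hn
      have hji : i ≠ j := fun h => hno _ hn (h ▸ hj)
      rw [Function.iterate_succ_apply', That_eq_of_mem_region hj]
      change ((α.That C C')^[n] x).1 i + (α.step j).1 i = _
      rw [ih, step_apply, Pi.single_eq_of_ne hji]
      push_cast
      ring
  obtain ⟨n, hn⟩ := exists_nat_gt ((C - x.1 i) / α.coord i)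
  rw [div_lt_iff₀ (α.pos i)] at hn
  have h1 := (h0.mem_Icc_of_mem_D (h0.mapsTo_That.iterate n hxD).1 i).2
  rw [hgrow] at h1
  linarith

theorem isFinitePolytopeUnion_piece (h0 : α.IsTijdemanParameters C C' 0) (hC : C < 1)
    (hC' : C' < 1) (i : Fin d) : IsFinitePolytopeUnion (α.piece C C' i) := by
  obtain ⟨𝒪, hfin, h𝒪, hcov⟩ := h0.exists_polyhedra hC hC'
  -- The polyhedra covering `D` are cut by the cells of index `i`. Empty intersections are discarded
  -- so that each closure has interior points.
  let 𝒜 : Set (Set (onePerp d)) :=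
    (⋃ F, (fun O => O ∩ α.cell C C' (F, i)) '' 𝒪) ∩ {A | A.Nonempty}
  have h𝒜fin : 𝒜.Finite := (finite_iUnion fun F => hfin.image _).inter_of_left _
  have hmem : ∀ x ∈ α.D C C' ∩ α.generic C C', x ∈ α.region C C' i → x ∈ ⋃₀ 𝒜 := by
    intro x hx hxi
    obtain ⟨O, hO, hxO⟩ := hcov hx
    obtain ⟨F, hF⟩ := mem_iUnion.1 hxi
    exact ⟨_, ⟨mem_iUnion.2 ⟨F, O, hO, rfl⟩, x, hxO, hF⟩, hxO, hF⟩
  have h𝒜 : ∀ A ∈ 𝒜, IsOpenPolyhedron A ∧ A.Nonempty ∧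
      A ⊆ interior (α.P C C') ∩ interior (α.S C C' i) := by
    rintro A ⟨hA, hne⟩
    obtain ⟨F, O, hO, rfl⟩ := mem_iUnion.1 hA
    refine ⟨(h𝒪 O hO).1.inter (α.isOpenPolyhedron_cell C C' _), hne, inter_subset_inter ?_ ?_⟩
    · refine interior_maximal ?_ (h𝒪 O hO).1.isOpen
      rw [h0.P_eq_closure h𝒪 hcov]
      exact (subset_sUnion_of_mem hO).trans subset_closure
    · exact (cell_subset_region (F, i)).trans (region_subset_interior_S i)
  refine ⟨closure '' 𝒜, h𝒜fin.image _, ?_, ?_, ?_⟩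
  · obtain ⟨x, hx, hxi⟩ := h0.exists_generic_mem_region hC hC' i
    obtain ⟨A, hA, -⟩ := hmem x hx hxi
    exact ⟨_, A, hA, rfl⟩
  · rintro _ ⟨A, hA, rfl⟩
    obtain ⟨hpoly, hne, hsub⟩ := h𝒜 A hA
    refine ⟨hpoly.isConvexPolytope_closure hne (h0.isCompact_P.isBounded.subset
      (hsub.trans (inter_subset_left.trans interior_subset))), hne.mono ?_⟩
    exact interior_maximal subset_closure hpoly.isOpen
  · rw [sUnion_image, ← h𝒜fin.closure_biUnion, ← sUnion_eq_biUnion]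
    apply Subset.antisymm
    · refine closure_minimal ?_ isClosed_closure
      refine (h0.dense_generic.open_subset_closure_inter
        (isOpen_interior.inter isOpen_interior)).trans (closure_mono ?_)
      rintro x ⟨hx, hxG⟩
      have hxD : x ∈ α.D C C' ∩ α.generic C C' := ⟨P_subset_D (interior_subset hx.1), hxG⟩
      obtain ⟨k, hk⟩ := h0.exists_mem_region_of_generic hxD
      obtain rfl := eq_of_mem_region_of_mem_S hk (interior_subset hx.2)
      exact hmem x hxD hk
    · exact closure_mono (sUnion_subset fun A hA => (h𝒜 A hA).2.2)

/-- The orbit of a generic point of `P` never leaves `D`, hence stays in the box. -/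
theorem ae_isTijdemanParameters (h0 : α.IsTijdemanParameters C C' 0) :
    ∀ᵐ x₀ ∂(lebOnePerp d).restrict (α.P C C'), α.IsTijdemanParameters C C' x₀ := by
  have hPm : MeasurableSet (α.P C C') := isClosed_closure.measurableSet
  rw [ae_restrict_iff' hPm]
  have hG : ∀ᵐ x ∂lebOnePerp d, x ∈ α.generic C C' := h0.leb_compl_generic
  filter_upwards [hG] with x hxG hx
  exact ⟨h0.totallyIrrational, h0.C_nonneg, h0.le_C', fun n i =>
    h0.mem_Icc_of_mem_D (h0.mapsTo_That.iterate n ⟨P_subset_D hx, hxG⟩).1 i⟩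

end IsTijdemanParameters

end FrequencyVector

/-! Conjugacy with the torus translation. -/

/-- A measurable fundamental domain, in the sense of `IsAddFundamentalDomain`. -/
theorem IsMeasurableFundamentalDomain.isAddFundamentalDomain {d : ℕ} {P : Set (onePerp d)}
    (h : IsMeasurableFundamentalDomain (lebOnePerp d) (onePerpLattice d) P) :
    IsAddFundamentalDomain (onePerpLattice d) P (lebOnePerp d) where
  nullMeasurableSet := h.measurableSet.nullMeasurableSet
  ae_covers := Eventually.of_forall fun x => by
    obtain ⟨y, hy, n, hn, rfl⟩ : x ∈ P + (onePerpLattice d : Set (onePerp d)) :=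
      h.add_lattice ▸ mem_univ x
    refine ⟨⟨-n, neg_mem hn⟩, ?_⟩
    change -n + (y + n) ∈ P
    rwa [add_comm y, neg_add_cancel_left]
  aedisjoint := by
    intro m n hmn
    change lebOnePerp d ((m.1 +ᵥ P) ∩ (n.1 +ᵥ P)) = 0
    have hne : n.1 - m.1 ≠ 0 := fun h => hmn (Subtype.ext (sub_eq_zero.1 h).symm)
    have h1 := h.null_overlap _ (sub_mem n.2 m.2) hne
    have h2 : (m.1 +ᵥ P) ∩ (n.1 +ᵥ P) = m.1 +ᵥ (P ∩ ((n.1 - m.1) +ᵥ P)) := by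
      rw [vadd_set_inter, vadd_vadd, add_sub_cancel]
    rw [h2, measure_vadd, h1]

namespace FrequencyVector

variable {d : ℕ} {α : FrequencyVector d} {C C' : ℝ}

namespace IsTijdemanParameters

theorem isProbabilityMeasure_cond (h0 : α.IsTijdemanParameters C C' 0) (hC : C < 1)
    (hC' : C' < 1) : IsProbabilityMeasure (ProbabilityTheory.cond (lebOnePerp d) (α.P C C')) := by
  refine ProbabilityTheory.cond_isProbabilityMeasure_of_finite ?_ h0.isCompact_P.measure_lt_top.ne
  exact (Measure.measure_pos_of_nonempty_interior _ (h0.interior_P_nonempty hC hC')).ne'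

/-- The pushforward is an invariant probability measure, hence Haar: `P` and its translate by `v`
are both fundamental domains, and a Λ-invariant set has the same measure in each. -/
theorem map_toTorus_cond (h0 : α.IsTijdemanParameters C C' 0) (hC : C < 1) (hC' : C' < 1) :
    (ProbabilityTheory.cond (lebOnePerp d) (α.P C C')).map (toTorus d) = volume := by
  have hprob := h0.isProbabilityMeasure_cond hC hC'
  have hfd := (h0.isMeasurableFundamentalDomain_P hC hC').isAddFundamentalDomain
  have hPm : MeasurableSet (α.P C C') := isClosed_closure.measurableSet
  have hmeas : Measurable (toTorus d) := continuous_toTorus.measurable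
  have hcount : Countable (onePerpLattice d) :=
    (α.countable_translationGroup.mono α.lattice_le_translationGroup).to_subtype
  set ρ := (ProbabilityTheory.cond (lebOnePerp d) (α.P C C')).map (toTorus d) with hρ
  have hρprob : IsProbabilityMeasure ρ := Measure.isProbabilityMeasure_map hmeas.aemeasurable
  have hinv : ρ.IsAddLeftInvariant := by
    refine ⟨fun t => ?_⟩
    obtain ⟨v, rfl⟩ := toTorus_surjective t
    ext E hE
    rw [Measure.map_apply (measurable_const_add _) hE, hρ,
      Measure.map_apply hmeas (measurable_const_add _ hE), Measure.map_apply hmeas hE,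
      ProbabilityTheory.cond_apply hPm, ProbabilityTheory.cond_apply hPm]
    congr 1
    have h1 : α.P C C' ∩ toTorus d ⁻¹' ((toTorus d v + ·) ⁻¹' E) =
        (v + ·) ⁻¹' (toTorus d ⁻¹' E ∩ (v +ᵥ α.P C C')) := by
      ext x
      simp [mem_vadd_set_iff_neg_vadd_mem, and_comm]
    rw [h1, measure_preimage_add, inter_comm (α.P C C')]
    refine (hfd.measure_set_eq (hfd.vadd_of_comm v) (hmeas hE) fun n => ?_).symm
    ext x
    have hn : toTorus d n.1 = 0 := toTorus_eq_zero_iff.2 n.2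
    change toTorus d (n.1 + x) ∈ E ↔ toTorus d x ∈ E
    rw [map_add, hn, zero_add]
  have h := Measure.isAddLeftInvariant_eq_smul ρ (volume : Measure (UnitAddTorus (Fin (d - 1))))
  have h1 := congrArg (fun m => m univ) h
  rw [Measure.smul_apply, measure_univ, measure_univ, ENNReal.smul_def, smul_eq_mul, mul_one] at h1
  rw [h, ENNReal.coe_eq_one.1 h1.symm, one_smul]

theorem measurablyConjugate (h0 : α.IsTijdemanParameters C C' 0) (hC : C < 1) (hC' : C' < 1) :
    MeasurablyConjugate (ProbabilityTheory.cond (lebOnePerp d) (α.P C C')) (α.That C C')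
      (volume : Measure (UnitAddTorus (Fin (d - 1)))) α.torusTranslation := by
  set μ := ProbabilityTheory.cond (lebOnePerp d) (α.P C C') with hμ
  have hprob : IsProbabilityMeasure μ := h0.isProbabilityMeasure_cond hC hC'
  have hmap := h0.map_toTorus_cond hC hC'
  have hPm : MeasurableSet (α.P C C') := isClosed_closure.measurableSet
  have hmeas : Measurable (toTorus d) := continuous_toTorus.measurable
  set X₀ := α.D C C' ∩ α.generic C C' with hX₀
  have hX₀m : MeasurableSet X₀ := isClosed_D.measurableSet.inter (α.measurableSet_generic C C')
  have hμX : ∀ᵐ x ∂μ, x ∈ X₀ := by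
    refine Measure.ae_smul_measure ?_ _
    rw [ae_restrict_iff' hPm]
    have hG : ∀ᵐ x ∂lebOnePerp d, x ∈ α.generic C C' := h0.leb_compl_generic
    filter_upwards [hG] with x hxG hx
    exact ⟨P_subset_D hx, hxG⟩
  have hpre : ∀ E, MeasurableSet E → μ (toTorus d ⁻¹' E) = volume E := fun E hE => by
    rw [← hmap, Measure.map_apply hmeas hE]
  have hinj := h0.injOn_toTorus hC hC'
  have hT : MeasurePreserving α.torusTranslation
      (volume : Measure (UnitAddTorus (Fin (d - 1)))) volume := by
    rw [funext α.torusTranslation_eq]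
    exact measurePreserving_add_right volume α.torusVector
  have hcomm : ∀ x ∈ X₀, toTorus d (α.That C C' x) = α.torusTranslation (toTorus d x) := by
    intro x hx
    rw [α.torusTranslation_eq, toTorus_That h0.le_C' fun j => (h0.mem_Icc_of_mem_D hx.1 j).1]
  have hS : MeasurePreserving (α.That C C') μ μ := by
    refine ⟨α.measurable_That C C', Measure.ext fun E hE => ?_⟩
    rw [Measure.map_apply (α.measurable_That C C') hE]
    -- Injective continuous images of Borel sets are Borel (Lusin–Souslin). Up to null sets `E` is
    -- the preimage of this set, so invariance is inherited from the torus.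
    have hF : MeasurableSet (toTorus d '' (E ∩ X₀)) :=
      (hE.inter hX₀m).image_of_continuousOn_injOn continuous_toTorus.continuousOn
        (hinj.mono inter_subset_right)
    have hmemF : ∀ x ∈ X₀, toTorus d x ∈ toTorus d '' (E ∩ X₀) ↔ x ∈ E := by
      intro x hx
      constructor
      · rintro ⟨y, hy, hyx⟩
        rw [← hinj hy.2 hx hyx]
        exact hy.1
      · exact fun h => ⟨x, ⟨h, hx⟩, rfl⟩
    calc μ (α.That C C' ⁻¹' E)
        = μ (toTorus d ⁻¹' (α.torusTranslation ⁻¹' (toTorus d '' (E ∩ X₀)))) := by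
          refine measure_congr ?_
          filter_upwards [hμX] with x hx
          refine propext ?_
          change α.That C C' x ∈ E ↔ α.torusTranslation (toTorus d x) ∈ toTorus d '' (E ∩ X₀)
          rw [← hcomm x hx]
          exact (hmemF _ (h0.mapsTo_That hx)).symm
      _ = μ (toTorus d ⁻¹' (toTorus d '' (E ∩ X₀))) := by
          rw [hpre _ (hT.measurable hF), hpre _ hF, hT.measure_preimage hF.nullMeasurableSet]
      _ = μ E := by
          refine measure_congr ?_
          filter_upwards [hμX] with x hx
          exact propext (hmemF x hx)
  have hμX1 : μ X₀ = 1 := (mem_ae_iff_prob_eq_one hX₀m).1 hμX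
  let g : X₀ → UnitAddTorus (Fin (d - 1)) := fun x => toTorus d x
  have hstd : StandardBorelSpace X₀ := hX₀m.standardBorel
  -- An injective measurable map on a standard Borel space has a measurable inverse on its range.
  have hg : MeasurableEmbedding g :=
    (hmeas.comp measurable_subtype_coe).measurableEmbedding hinj.injective
  have hgr : ∀ x, (hg.equivRange x : UnitAddTorus (Fin (d - 1))) = toTorus d x := fun x =>
    congrArg Subtype.val (hg.equivRange_apply x)
  have hYm : MeasurableSet (range g) := hg.measurableSet_range
  have hνY : volume (range g) = 1 := by
    rw [← hpre _ hYm]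
    refine le_antisymm prob_le_one ?_
    rw [← hμX1]
    exact measure_mono fun x hx => ⟨⟨x, hx⟩, rfl⟩
  refine ⟨hprob, inferInstance, hS, hT, X₀, range g, h0.mapsTo_That, ?_, hg.equivRange, hX₀m, hYm,
    hμX1, hνY, ⟨hg.equivRange.measurable, Measure.ext fun E hE => ?_⟩, ?_⟩
  · rintro _ ⟨x, rfl⟩
    exact ⟨⟨_, h0.mapsTo_That x.2⟩, hcomm x x.2⟩
  · rw [Measure.map_apply hg.equivRange.measurable hE,
      (MeasurableEmbedding.subtype_coe hX₀m).comap_apply,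
      (MeasurableEmbedding.subtype_coe hYm).comap_apply, ← hpre _ (hYm.subtype_image hE)]
    refine measure_congr ?_
    filter_upwards [hμX] with x hx
    refine propext ⟨?_, ?_⟩
    · rintro ⟨y, hy, rfl⟩
      exact ⟨hg.equivRange y, hy, hgr y⟩
    · rintro ⟨y, hy, hyx⟩
      refine ⟨⟨x, hx⟩, ?_, rfl⟩
      have : hg.equivRange ⟨x, hx⟩ = y := Subtype.ext ((hgr _).trans hyx.symm)
      change hg.equivRange ⟨x, hx⟩ ∈ E
      rwa [this]
  · intro x
    rw [hgr, hgr]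
    exact hcomm x x.2

end IsTijdemanParameters

end FrequencyVector

theorem propositionp (d : ℕ) (α : FrequencyVector d) (C C' : ℝ)
    (hC : C ∈ Set.Ico (1 - (1 + ⨅ i, α.coord i) / (2 * (d : ℝ) - 2)) 1)
    (hC' : C' ∈ Set.Ico (1 - (1 + ⨅ i, α.coord i) / (2 * (d : ℝ) - 2)) 1)
    (h0 : α.IsTijdemanParameters C C' 0) :
    IsMeasurableFundamentalDomain (lebOnePerp d) (onePerpLattice d) (α.P C C') ∧
    IsNaturalPartition (lebOnePerp d) (onePerpLattice d) (α.step α.last)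
      (α.P C C') (α.piece C C') ∧
    MeasurablyConjugate (ProbabilityTheory.cond (lebOnePerp d) (α.P C C')) (α.That C C')
      (volume : Measure (UnitAddTorus (Fin (d - 1)))) α.torusTranslation ∧
    (∀ i, IsFinitePolytopeUnion (α.piece C C' i)) ∧
    ∀ᵐ x₀ ∂(lebOnePerp d).restrict (α.P C C'), α.IsTijdemanParameters C C' x₀ :=
  ⟨h0.isMeasurableFundamentalDomain_P hC.2 hC'.2, h0.isNaturalPartition_piece hC.2 hC'.2,
    h0.measurablyConjugate hC.2 hC'.2, h0.isFinitePolytopeUnion_piece hC.2 hC'.2,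
    h0.ae_isTijdemanParameters⟩
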